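/- Let $\mathbb{K}\in\{\mathbb{R},\mathbb{C}\}$ and let $\ell,n,m\geq 1$ be integers. For $E,A\in\mathbb{K}^{\ell\times n}$ and $B\in\mathbb{K}^{\ell\times m}$ let the behaviour $\mathfrak{B}_{[E,A,B]}$ be the set of all $(x,u)\in L^1_{\mathrm{loc}}(\mathbb{R},\mathbb{K}^n)\times L^1_{\mathrm{loc}}(\mathbb{R},\mathbb{K}^m)$ such that $Ex$ is locally absolutely continuous and $\frac{\mathrm d}{\mathrm dt}(Ex)=Ax+Bu$ almost everywhere. The system $[E,A,B]$ is called - freely initializable if for every $x^0\in\mathbb{K}^n$ there is $(x,u)\in\mathfrak{B}_{[E,A,B]}$ with $x(0)=x^0$; - impulse controllable if for every $x^0\in\mathbb{K}^n$ there is $(x,u)\in\mathfrak{B}_{[E,A,B]}$ with $Ex(0)=Ex^0$; - behaviourally controllable if for all $(x_1,u_1),(x_2,u_2)\in\mathfrak{B}_{[E,A,B]}$ there are $T>0$ and $(x,u)\in\mathfrak{B}_{[E,A,B]}$ with $(x,u)(t)=(x_1,u_1)(t)$ for $t<0$ and $(x,u)(t)=(x_2,u_2)(t)$ for $t>T$;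 - completely controllable if there is $T>0$ such that for all $x^0,x_T\in\mathbb{K}^n$ there is $(x,u)\in\mathfrak{B}_{[E,A,B]}$ with $x(0)=x^0$ and $x(T)=x_T$; - strongly controllable if there is $T>0$ such that for all $x^0,x_T\in\mathbb{K}^n$ there is $(x,u)\in\mathfrak{B}_{[E,A,B]}$ with $Ex(0)=Ex^0$ and $Ex(T)=Ex_T$. Here a condition $x(t_0)=v$ on a locally integrable $x$ means that $x$ is continuous at $t_0$ with value $v$. Let $$\Sigma^{H}=\{(E,J,Q,B)\mid J=-J^*,\ E^*Q=Q^*E\geq 0\},$$ $$\Sigma^{sdH}=\{(E,J,R,Q,B)\mid J=-J^*,\ R=R^*\geq 0,\ E^*Q=Q^*E\geq 0\},$$ $$\Sigma^{dH}=\{(E,J,R,Q,B)\mid J=-J^*,\ R=R^*>0,\ E^*Q=Q^*E\geq 0\},$$ where $E,Q\in\mathbb{K}^{\ell\times n}$, $J,R\in\mathbb{K}^{\ell\times\ell}$ and $B\in\mathbb{K}^{\ell\times m}$. For each of the five concepts $c$ let $S_c^{H}$ be the set of $(E,J,Q,B)\in\Sigma^{H}$ such that $[E,JQ,B]$ has property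 $c$, and let $S_c^{sdH}$ and $S_c^{dH}$ be the sets of $(E,J,R,Q,B)$ in $\Sigma^{sdH}$ and $\Sigma^{dH}$, respectively, such that $[E,(J-R)Q,B]$ has property $c$. For subsets $S,V$ of a finite-dimensional real vector space, identified with $\mathbb{R}^N$ by a linear isomorphism (spaces of complex matrices are regarded as real vector spaces), $S$ is called relative generic in $V$ if there is a set $\mathbb{V}\subseteq\mathbb{R}^N$, the common zero set of finitely many real polynomials, such that $S^c\cap V\subseteq\mathbb{V}$ and $\mathbb{V}^c\cap V$ is dense in $V$ in the Euclidean topology. Then for each $*\in\{H,sdH,dH\}$: 1. $S^{*}_{\text{freely initializable}}$ is relative generic in $\Sigma^{*}$ if and only if $\ell\leq n+m$; 2. $S^{*}_{\text{impulse controllable}}$ is relative generic in $\Sigma^{*}$ if and only if $\ell\leq n+m$; 3. $S^{*}_{\text{behaviourally controllable}}$ is relative generic in $\Sigma^{*}$ if and only if $\ell\neq n+m$; 4. $S^{*}_{\text{completely controllable}}$ is relative generic in $\Sigma^{*}$ if and only if $\ell<n+m$; 5. $S^{*}_{\text{strongly controllable}}$ is relative generic in $\Sigma^{*}$ if and only if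 $\ell<n+m$. Moreover, for each of the five concepts $c$, if $S_c^{*}$ is not relative generic in $\Sigma^{*}$, then its complement $(S_c^{*})^c$ is relative generic in $\Sigma^{*}$. -/

import Mathlib

open scoped Matrix ComplexOrder

namespace PortHamiltonian

/-! ### Relative genericity -/

/-- Real algebraic sets: common zero sets of finitely many real polynomials in `N` variables. -/
def IsAlgebraicSet {N : ℕ} (W : Set (Fin N → ℝ)) : Prop :=
  ∃ (k : ℕ) (p : Fin k → MvPolynomial (Fin N) ℝ),
    W = {x | ∀ i, MvPolynomial.eval x (p i) = 0}

/-- `S` is relative generic in `V` (both subsets of `ℝ^N`): outside an algebraic set `W` every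
point of `V` lies in `S`, and `Wᶜ ∩ V` is dense in `V` for the Euclidean topology. -/
def RelGenericReal {N : ℕ} (S V : Set (Fin N → ℝ)) : Prop :=
  ∃ W : Set (Fin N → ℝ), IsAlgebraicSet W ∧ Sᶜ ∩ V ⊆ W ∩ V ∧ V ⊆ closure (Wᶜ ∩ V)

/-- Relative genericity in a finite-dimensional real vector space `X` (for instance a space of
tuples of real or complex matrices), through a real-linear isomorphism `X ≃ ℝ^N`. Linear changes
of coordinates preserve algebraic sets and density, so the choice of `φ` does not matter. -/
def RelGeneric {X : Type*} [AddCommGroup X] [Module ℝ X] (S V : Set X) : Prop :=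
  ∃ (N : ℕ) (φ : X ≃ₗ[ℝ] (Fin N → ℝ)), RelGenericReal (φ '' S) (φ '' V)

/-! ### Differential-algebraic systems `d/dt (E x) = A x + B u` -/

section DAE

variable {𝕜 : Type*} [RCLike 𝕜] {ℓ n m : ℕ}

/-- The behaviour of `d/dt (E x) = A x + B u`: locally integrable `x, u` on `ℝ` such that `E x` is
(locally) absolutely continuous and the equation holds almost everywhere. -/
def behaviour (E A : Matrix (Fin ℓ) (Fin n) 𝕜) (B : Matrix (Fin ℓ) (Fin m) 𝕜) :
    Set ((ℝ → Fin n → 𝕜) × (ℝ → Fin m → 𝕜)) :=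
  {w | MeasureTheory.LocallyIntegrable w.1 ∧ MeasureTheory.LocallyIntegrable w.2 ∧
    (∀ a b : ℝ, AbsolutelyContinuousOnInterval (fun t => E *ᵥ w.1 t) a b) ∧
    ∀ᵐ t : ℝ, HasDerivAt (fun s => E *ᵥ w.1 s) (A *ᵥ w.1 t + B *ᵥ w.2 t) t}

/-- `x(t) = v` for a locally integrable `x`. Point values of such a function can be altered at
will on a null set; the value at `t` is understood to be attained continuously. -/
def HasValueAt (x : ℝ → Fin n → 𝕜) (t : ℝ) (v : Fin n → 𝕜) : Prop :=
  ContinuousAt x t ∧ x t = v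

def FreelyInitializable (E A : Matrix (Fin ℓ) (Fin n) 𝕜) (B : Matrix (Fin ℓ) (Fin m) 𝕜) : Prop :=
  ∀ x₀ : Fin n → 𝕜, ∃ w ∈ behaviour E A B, HasValueAt w.1 0 x₀

/-- Here and in `StronglyControllable`, `E x` is continuous, so its point values are meaningful. -/
def ImpulseControllable (E A : Matrix (Fin ℓ) (Fin n) 𝕜) (B : Matrix (Fin ℓ) (Fin m) 𝕜) : Prop :=
  ∀ x₀ : Fin n → 𝕜, ∃ w ∈ behaviour E A B, E *ᵥ w.1 0 = E *ᵥ x₀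

def BehaviourallyControllable (E A : Matrix (Fin ℓ) (Fin n) 𝕜) (B : Matrix (Fin ℓ) (Fin m) 𝕜) :
    Prop :=
  ∀ w₁ ∈ behaviour E A B, ∀ w₂ ∈ behaviour E A B, ∃ T : ℝ, 0 < T ∧ ∃ w ∈ behaviour E A B,
    (∀ t < 0, w.1 t = w₁.1 t ∧ w.2 t = w₁.2 t) ∧ (∀ t > T, w.1 t = w₂.1 t ∧ w.2 t = w₂.2 t)

def CompletelyControllable (E A : Matrix (Fin ℓ) (Fin n) 𝕜) (B : Matrix (Fin ℓ) (Fin m) 𝕜) :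
    Prop :=
  ∃ T : ℝ, 0 < T ∧ ∀ x₀ x_T : Fin n → 𝕜, ∃ w ∈ behaviour E A B,
    HasValueAt w.1 0 x₀ ∧ HasValueAt w.1 T x_T

def StronglyControllable (E A : Matrix (Fin ℓ) (Fin n) 𝕜) (B : Matrix (Fin ℓ) (Fin m) 𝕜) :
    Prop :=
  ∃ T : ℝ, 0 < T ∧ ∀ x₀ x_T : Fin n → 𝕜, ∃ w ∈ behaviour E A B,
    E *ᵥ w.1 0 = E *ᵥ x₀ ∧ E *ᵥ w.1 T = E *ᵥ x_T

end DAE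

/-- Names of the five controllability concepts. -/
inductive CtrlConcept
  | freelyInitializable
  | impulseControllable
  | behaviourallyControllable
  | completelyControllable
  | stronglyControllable

/-- The system `d/dt (E x) = A x + B u` has the controllability property named by the concept. -/
def CtrlConcept.Holds {𝕜 : Type*} [RCLike 𝕜] {ℓ n m : ℕ} (c : CtrlConcept)
    (E A : Matrix (Fin ℓ) (Fin n) 𝕜) (B : Matrix (Fin ℓ) (Fin m) 𝕜) : Prop :=
  match c with
  | .freelyInitializable => FreelyInitializable E A B
  | .impulseControllable => ImpulseControllable E A B
  | .behaviourallyControllable => BehaviourallyControllable E A B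
  | .completelyControllable => CompletelyControllable E A B
  | .stronglyControllable => StronglyControllable E A B

/-! ### Port-Hamiltonian systems -/

section Classes

variable (𝕜 : Type*) [RCLike 𝕜] (ℓ n m : ℕ)

/-- Quadruples `(E, J, Q, B)`. -/
abbrev Quadruple : Type _ :=
  Matrix (Fin ℓ) (Fin n) 𝕜 × Matrix (Fin ℓ) (Fin ℓ) 𝕜 × Matrix (Fin ℓ) (Fin n) 𝕜 ×
    Matrix (Fin ℓ) (Fin m) 𝕜

/-- Quintuples `(E, J, R, Q, B)`. -/
abbrev Quintuple : Type _ :=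
  Matrix (Fin ℓ) (Fin n) 𝕜 × Matrix (Fin ℓ) (Fin ℓ) 𝕜 × Matrix (Fin ℓ) (Fin ℓ) 𝕜 ×
    Matrix (Fin ℓ) (Fin n) 𝕜 × Matrix (Fin ℓ) (Fin m) 𝕜

/-- `Σ^H`: conservative systems, `J = -J*`, `E*Q = Q*E ≥ 0`. -/
def SigmaH : Set (Quadruple 𝕜 ℓ n m) :=
  {(E, J, Q, _B) | J = -Jᴴ ∧ Eᴴ * Q = Qᴴ * E ∧ (Eᴴ * Q).PosSemidef}

/-- `Σ^sdH`: semi-dissipative systems, `J = -J*`, `R = R* ≥ 0`, `E*Q = Q*E ≥ 0`. -/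
def SigmaSdH : Set (Quintuple 𝕜 ℓ n m) :=
  {(E, J, R, Q, _B) | J = -Jᴴ ∧ R = Rᴴ ∧ R.PosSemidef ∧ Eᴴ * Q = Qᴴ * E ∧ (Eᴴ * Q).PosSemidef}

/-- `Σ^dH`: dissipative systems, `J = -J*`, `R = R* > 0`, `E*Q = Q*E ≥ 0`. -/
def SigmaDH : Set (Quintuple 𝕜 ℓ n m) :=
  {(E, J, R, Q, _B) | J = -Jᴴ ∧ R = Rᴴ ∧ R.PosDef ∧ Eᴴ * Q = Qᴴ * E ∧ (Eᴴ * Q).PosSemidef}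

/-- The systems in `Σ^H` with the given controllability property. -/
def ctrlH (c : CtrlConcept) : Set (Quadruple 𝕜 ℓ n m) :=
  {(E, J, Q, B) | (E, J, Q, B) ∈ SigmaH 𝕜 ℓ n m ∧ c.Holds E (J * Q) B}

/-- The systems in `Σ^sdH` with the given controllability property. -/
def ctrlSdH (c : CtrlConcept) : Set (Quintuple 𝕜 ℓ n m) :=
  {(E, J, R, Q, B) | (E, J, R, Q, B) ∈ SigmaSdH 𝕜 ℓ n m ∧ c.Holds E ((J - R) * Q) B}

/-- The systems in `Σ^dH` with the given controllability property. -/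
def ctrlDH (c : CtrlConcept) : Set (Quintuple 𝕜 ℓ n m) :=
  {(E, J, R, Q, B) | (E, J, R, Q, B) ∈ SigmaDH 𝕜 ℓ n m ∧ c.Holds E ((J - R) * Q) B}

end Classes

end PortHamiltonian

open PortHamiltonian

/-!
In `ℝ^N` genericity amounts to one real polynomial `f` whose zero set contains all exceptions and
whose nonzero set is dense in the class. For density, replace `E` by `E + ε Q`: then `Q = T E` with
`T` positive semidefinite, and along the polynomial path on which `T` moves to `1` and the remaining
data move linearly to a chosen system with `Q = E`, the system stays in the class until the end and
`f` vanishes only finitely often. So it is enough that `f` does not vanish at one system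
`[E, J E, B]` with `J` skew-Hermitian, which is taken with tridiagonal `J` and truncated, possibly
shifted identities `E`, `B`.

The condition `f ≠ 0` expresses injectivity of a matrix built from `E`, `A`, `B`:
* if `ℓ > n + m`, of the derivative array of `E x' = A x + B u`, which forces `x = 0`;
* if `ℓ = n + m`, of `[E, -B]`, which turns the equation into an ODE `x' = F x` without free input;
* if `ℓ < n + m`, of the transposed array, which makes `[E, -B]` surjective and the resulting
  control system `x' = F x + G v` satisfy the Kalman condition.
-/

namespace PortHamiltonian

section Polynomial

/-- The algebra of real polynomial functions on a real vector space, generated by its linear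
functionals so that no choice of coordinates is involved. -/
def polyFun (Y : Type*) [AddCommGroup Y] [Module ℝ Y] : Subalgebra ℝ (Y → ℝ) :=
  Algebra.adjoin ℝ (Set.range fun g : Module.Dual ℝ Y => (g : Y → ℝ))

/-- Polynomial maps between real vector spaces: those whose composites with linear functionals are
polynomial functions. -/
def IsPolynomialMap {Y W : Type*} [AddCommGroup Y] [Module ℝ Y] [AddCommGroup W] [Module ℝ W]
    (h : Y → W) : Prop :=
  ∀ g : Module.Dual ℝ W, (fun y => g (h y)) ∈ polyFun Y

variable {Y W W₁ W₂ : Type*} [AddCommGroup Y] [Module ℝ Y] [AddCommGroup W] [Module ℝ W]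
  [AddCommGroup W₁] [Module ℝ W₁] [AddCommGroup W₂] [Module ℝ W₂]

namespace IsPolynomialMap

theorem comp_mem_polyFun {f : W → ℝ} (hf : f ∈ polyFun W) {h : Y → W} (hh : IsPolynomialMap h) :
    (fun y => f (h y)) ∈ polyFun Y := by
  induction hf using Algebra.adjoin_induction with
  | mem f hf =>
    obtain ⟨g, rfl⟩ := hf
    exact hh g
  | algebraMap r => exact (polyFun Y).algebraMap_mem r
  | add f₁ f₂ _ _ h₁ h₂ => exact (polyFun Y).add_mem h₁ h₂
  | mul f₁ f₂ _ _ h₁ h₂ => exact (polyFun Y).mul_mem h₁ h₂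

theorem of_linearMap (L : Y →ₗ[ℝ] W) : IsPolynomialMap fun y => L y := fun g =>
  Algebra.subset_adjoin ⟨g ∘ₗ L, rfl⟩

theorem const (w : W) : IsPolynomialMap fun _ : Y => w := fun g =>
  (polyFun Y).algebraMap_mem (g w)

theorem add {h k : Y → W} (hh : IsPolynomialMap h) (hk : IsPolynomialMap k) :
    IsPolynomialMap fun y => h y + k y := fun g => by
  simp only [map_add]
  exact (polyFun Y).add_mem (hh g) (hk g)

theorem sum {ι : Type*} (s : Finset ι) {h : ι → Y → W} (hh : ∀ i ∈ s, IsPolynomialMap (h i)) :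
    IsPolynomialMap fun y => ∑ i ∈ s, h i y := fun g => by
  convert (polyFun Y).sum_mem fun i hi => hh i hi g using 1
  ext y
  simp only [map_sum, Finset.sum_apply]

theorem linearMap_comp (L : W →ₗ[ℝ] W₁) {h : Y → W} (hh : IsPolynomialMap h) :
    IsPolynomialMap fun y => L (h y) := fun g => hh (g ∘ₗ L)

theorem fst {h : Y → W₁ × W₂} (hh : IsPolynomialMap h) : IsPolynomialMap fun y => (h y).1 :=
  hh.linearMap_comp (LinearMap.fst ℝ W₁ W₂)

theorem snd {h : Y → W₁ × W₂} (hh : IsPolynomialMap h) : IsPolynomialMap fun y => (h y).2 :=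
  hh.linearMap_comp (LinearMap.snd ℝ W₁ W₂)

theorem prodMk {h : Y → W₁} {k : Y → W₂} (hh : IsPolynomialMap h) (hk : IsPolynomialMap k) :
    IsPolynomialMap fun y => (h y, k y) := by
  simpa using
    (hh.linearMap_comp (LinearMap.inl ℝ W₁ W₂)).add (hk.linearMap_comp (LinearMap.inr ℝ W₁ W₂))

theorem lineMap (w₀ w₁ : W) : IsPolynomialMap (AffineMap.lineMap w₀ w₁ : ℝ → W) := by
  have h := (of_linearMap (LinearMap.toSpanSingleton ℝ W (w₁ - w₀))).add (const w₀)
  convert h using 1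
  ext t
  simp [AffineMap.lineMap_apply]

theorem bilinear [FiniteDimensional ℝ W₁] (b : W₁ →ₗ[ℝ] W₂ →ₗ[ℝ] W) {h : Y → W₁} {k : Y → W₂}
    (hh : IsPolynomialMap h) (hk : IsPolynomialMap k) :
    IsPolynomialMap fun y => b (h y) (k y) := fun g => by
  let e := Module.finBasis ℝ W₁
  have hexpand : (fun y => g (b (h y) (k y))) =
      ∑ i, (fun y => e.coord i (h y)) * fun y => (g ∘ₗ b (e i)) (k y) := by
    ext y
    conv_lhs => rw [← e.sum_repr (h y)]
    simp [-Module.Basis.sum_repr]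
  rw [hexpand]
  exact (polyFun Y).sum_mem fun i _ => (polyFun Y).mul_mem (hh _) (hk _)

section Matrix

variable {𝕜 : Type*} [RCLike 𝕜]

theorem mul {h k : Y → 𝕜} (hh : IsPolynomialMap h) (hk : IsPolynomialMap k) :
    IsPolynomialMap fun y => h y * k y :=
  bilinear (LinearMap.mul ℝ 𝕜) hh hk

theorem prod {ι : Type*} (s : Finset ι) {h : ι → Y → 𝕜} (hh : ∀ i ∈ s, IsPolynomialMap (h i)) :
    IsPolynomialMap fun y => ∏ i ∈ s, h i y := by
  classical
  induction s using Finset.induction_on with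
  | empty => simpa using const (1 : 𝕜)
  | insert a s ha ih =>
    simp only [Finset.prod_insert ha]
    exact (hh a (by simp)).mul (ih fun i hi => hh i (by simp [hi]))

theorem matrix_mul {a b c : Type*} [Finite a] [Fintype b] {h : Y → Matrix a b 𝕜}
    {k : Y → Matrix b c 𝕜} (hh : IsPolynomialMap h) (hk : IsPolynomialMap k) :
    IsPolynomialMap fun y => h y * k y :=
  bilinear (mulLinearMap ℝ) hh hk

theorem det {κ : Type*} [Fintype κ] [DecidableEq κ] {h : Y → Matrix κ κ 𝕜}
    (hh : IsPolynomialMap h) : IsPolynomialMap fun y => (h y).det := by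
  simp only [Matrix.det_apply']
  exact sum _ fun σ _ => (const _).mul <| prod _ fun i _ =>
    hh.linearMap_comp (Matrix.entryLinearMap ℝ 𝕜 (σ i) i)

theorem normSq_mem_polyFun {h : Y → 𝕜} (hh : IsPolynomialMap h) :
    (fun y => RCLike.normSq (h y)) ∈ polyFun Y := by
  simp only [RCLike.normSq_apply]
  exact (polyFun Y).add_mem ((polyFun Y).mul_mem (hh RCLike.reLm) (hh RCLike.reLm))
    ((polyFun Y).mul_mem (hh RCLike.imLm) (hh RCLike.imLm))

end Matrix

end IsPolynomialMap

theorem mem_polyFun_iff {N : ℕ} (φ : Y ≃ₗ[ℝ] (Fin N → ℝ)) {f : Y → ℝ} :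
    f ∈ polyFun Y ↔ ∃ p : MvPolynomial (Fin N) ℝ, f = fun y => MvPolynomial.eval (φ y) p := by
  let coord : Fin N → Y → ℝ := fun i y => φ y i
  have haeval (p : MvPolynomial (Fin N) ℝ) :
      MvPolynomial.aeval coord p = fun y => MvPolynomial.eval (φ y) p := by
    ext y
    exact (MvPolynomial.comp_aeval_apply coord (Pi.evalAlgHom ℝ (fun _ : Y => ℝ) y) p).trans
      (congrArg (· p) (MvPolynomial.coe_aeval_eq_eval (φ y)))
  have hadjoin : polyFun Y = Algebra.adjoin ℝ (Set.range coord) := by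
    refine le_antisymm (Algebra.adjoin_le (Set.range_subset_iff.2 fun g => ?_))
      (Algebra.adjoin_mono (Set.range_subset_iff.2 fun i =>
        ⟨LinearMap.proj i ∘ₗ φ.toLinearMap, rfl⟩))
    have hg : (g : Y → ℝ) = ∑ i, g (φ.symm (Pi.single i 1)) • coord i := by
      ext y
      conv_lhs => rw [← φ.symm_apply_apply y, pi_eq_sum_univ' (φ y)]
      simp [coord, mul_comm]
    rw [hg]
    exact Subalgebra.sum_mem _ fun i _ =>
      Subalgebra.smul_mem _ (Algebra.subset_adjoin (Set.mem_range_self i)) _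
  rw [hadjoin, Algebra.adjoin_range_eq_range_aeval]
  simp only [AlgHom.mem_range, haeval, eq_comm]

theorem analyticOnNhd_of_mem_polyFun {Y : Type*} [NormedAddCommGroup Y] [NormedSpace ℝ Y]
    [FiniteDimensional ℝ Y] {f : Y → ℝ} (hf : f ∈ polyFun Y) : AnalyticOnNhd ℝ f Set.univ := by
  induction hf using Algebra.adjoin_induction with
  | mem f hf =>
    obtain ⟨g, rfl⟩ := hf
    exact g.toContinuousLinearMap.analyticOnNhd _
  | algebraMap r => exact analyticOnNhd_const
  | add f₁ f₂ _ _ h₁ h₂ => exact h₁.add h₂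
  | mul f₁ f₂ _ _ h₁ h₂ => exact h₁.mul h₂

theorem eventually_ne_zero_of_mem_polyFun {f : ℝ → ℝ} (hf : f ∈ polyFun ℝ) {s : ℝ} (hs : f s ≠ 0)
    (a : ℝ) : ∀ᶠ t in nhdsWithin a (Set.Ioi a), f t ≠ 0 := by
  have hf' := analyticOnNhd_of_mem_polyFun hf
  obtain h | h := (hf' a (Set.mem_univ a)).eventually_eq_zero_or_eventually_ne_zero
  · exact absurd (congrFun (hf'.eq_of_eventuallyEq analyticOnNhd_const h) s) hs
  · exact h.filter_mono (nhdsWithin_mono a fun t ht => ne_of_gt ht)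

end Polynomial

section RelativeGenericity

theorem relGeneric_preimage_iff {X X' : Type*} [AddCommGroup X] [Module ℝ X] [AddCommGroup X']
    [Module ℝ X'] (e : X ≃ₗ[ℝ] X') {S V : Set X'} :
    RelGeneric (e ⁻¹' S) (e ⁻¹' V) ↔ RelGeneric S V := by
  have himage {N : ℕ} (φ : X' ≃ₗ[ℝ] (Fin N → ℝ)) (U : Set X') :
      e.trans φ '' (e ⁻¹' U) = φ '' U :=
    (Set.image_comp φ e _).trans (by rw [Set.image_preimage_eq _ e.surjective])
  constructor
  · rintro ⟨N, φ, h⟩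
    refine ⟨N, e.symm.trans φ, ?_⟩
    have hφ : e.trans (e.symm.trans φ) = φ := LinearEquiv.ext fun x => by simp
    rwa [← himage, ← himage, hφ]
  · rintro ⟨N, φ, h⟩
    refine ⟨N, e.trans φ, ?_⟩
    rwa [himage, himage]

variable {X : Type*} [AddCommGroup X] [Module ℝ X] [TopologicalSpace X] [IsTopologicalAddGroup X]
  [ContinuousSMul ℝ X] {S V : Set X}

theorem RelGeneric.exists_polyFun (h : RelGeneric S V) :
    ∃ f ∈ polyFun X, (∀ x ∈ V, f x ≠ 0 → x ∈ S) ∧ V ⊆ closure {x ∈ V | f x ≠ 0} := by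
  obtain ⟨N, φ, W, ⟨k, p, rfl⟩, hS, hd⟩ := h
  have : FiniteDimensional ℝ X := φ.symm.finiteDimensional
  have hφ : Continuous φ.symm := φ.symm.toLinearMap.continuous_of_finiteDimensional
  have hzero (x : X) : MvPolynomial.eval (φ x) (∑ i, p i ^ 2) = 0 ↔
      φ x ∈ {x | ∀ i, MvPolynomial.eval x (p i) = 0} := by
    simp [Finset.sum_eq_zero_iff_of_nonneg, sq_nonneg]
  refine ⟨_, (mem_polyFun_iff φ).2 ⟨∑ i, p i ^ 2, rfl⟩, fun x hx hfx => ?_, fun x hx => ?_⟩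
  · by_contra hxS
    refine hfx ((hzero x).2 (hS ⟨?_, x, hx, rfl⟩).1)
    rintro ⟨y, hy, hyx⟩
    exact hxS (φ.injective hyx ▸ hy)
  · have hx' := image_closure_subset_closure_image hφ ⟨φ x, hd ⟨x, hx, rfl⟩, rfl⟩
    rw [LinearEquiv.symm_apply_apply] at hx'
    refine closure_mono ?_ hx'
    rintro _ ⟨_, ⟨hy, y, hyV, rfl⟩, rfl⟩
    rw [LinearEquiv.symm_apply_apply]
    exact ⟨hyV, fun hfy => hy ((hzero y).1 hfy)⟩

variable [T2Space X]

theorem continuous_of_mem_polyFun [FiniteDimensional ℝ X] {f : X → ℝ} (hf : f ∈ polyFun X) :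
    Continuous f := by
  induction hf using Algebra.adjoin_induction with
  | mem f hf =>
    obtain ⟨g, rfl⟩ := hf
    exact g.continuous_of_finiteDimensional
  | algebraMap r => exact continuous_const
  | add f₁ f₂ _ _ h₁ h₂ => exact h₁.add h₂
  | mul f₁ f₂ _ _ h₁ h₂ => exact h₁.mul h₂

theorem IsPolynomialMap.continuous [FiniteDimensional ℝ X] {W : Type*} [AddCommGroup W]
    [Module ℝ W] [TopologicalSpace W] [IsTopologicalAddGroup W] [ContinuousSMul ℝ W] [T2Space W]
    [FiniteDimensional ℝ W] {h : X → W} (hh : IsPolynomialMap h) : Continuous h := by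
  let φ := (Module.finBasis ℝ W).equivFunL
  rw [← φ.comp_continuous_iff]
  exact continuous_pi fun i => continuous_of_mem_polyFun (hh ((Module.finBasis ℝ W).coord i))

theorem relGeneric_of_polyFun [FiniteDimensional ℝ X] {f : X → ℝ} (hf : f ∈ polyFun X)
    (hS : ∀ x ∈ V, f x ≠ 0 → x ∈ S) (hV : V ⊆ closure {x ∈ V | f x ≠ 0}) : RelGeneric S V := by
  let φ : X ≃ₗ[ℝ] (Fin (Module.finrank ℝ X) → ℝ) := (Module.finBasis ℝ X).equivFun
  have hφ : Continuous φ := φ.toLinearMap.continuous_of_finiteDimensional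
  obtain ⟨p, rfl⟩ := (mem_polyFun_iff φ).1 hf
  refine ⟨_, φ, {x | MvPolynomial.eval x p = 0}, ⟨1, fun _ => p, by simp⟩, ?_, ?_⟩
  · rintro _ ⟨hxS, x, hx, rfl⟩
    exact ⟨by_contra fun h => hxS ⟨x, hS x hx h, rfl⟩, x, hx, rfl⟩
  · rintro _ ⟨x, hx, rfl⟩
    refine closure_mono ?_ (image_closure_subset_closure_image hφ ⟨x, hV hx, rfl⟩)
    rintro _ ⟨y, ⟨hy, hy0⟩, rfl⟩
    exact ⟨hy0, y, hy, rfl⟩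

theorem RelGeneric.not_compl (h : RelGeneric S V) (hV : V.Nonempty) : ¬ RelGeneric Sᶜ V := by
  intro h'
  have : FiniteDimensional ℝ X := let ⟨_, φ, _⟩ := h; φ.symm.finiteDimensional
  obtain ⟨f, hf, hfS, hfd⟩ := h.exists_polyFun
  obtain ⟨g, -, hgS, hgd⟩ := h'.exists_polyFun
  obtain ⟨x, hxV, hx⟩ := closure_nonempty_iff.1 (hV.mono hfd)
  have hopen : IsOpen {x | f x ≠ 0} := isOpen_ne_fun (continuous_of_mem_polyFun hf) continuous_const
  obtain ⟨y, hfy, hyV, hgy⟩ := mem_closure_iff.1 (hgd hxV) _ hopen hx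
  exact hgS y hyV hgy (hfS y hyV hfy)

theorem mem_closure_of_isPolynomialMap [FiniteDimensional ℝ X] {f : X → ℝ} (hf : f ∈ polyFun X)
    {γ : ℝ → X} (hγ : IsPolynomialMap γ) (hV : ∀ t ∈ Set.Ioo 0 1, γ t ∈ V)
    (h₁ : f (γ 1) ≠ 0) : γ 0 ∈ closure {x ∈ V | f x ≠ 0} := by
  refine mem_closure_of_tendsto
    (hγ.continuous.continuousAt.mono_left (nhdsWithin_le_nhds (s := Set.Ioi 0))) ?_
  filter_upwards [eventually_ne_zero_of_mem_polyFun (hγ.comp_mem_polyFun hf) h₁ 0,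
    Ioo_mem_nhdsGT one_pos] with t hft ht
  exact ⟨hV t ht, hft⟩

end RelativeGenericity

section Density

variable {𝕜 : Type*} [RCLike 𝕜]

instance {a b c d : ℕ} :
    FiniteDimensional ℝ (Matrix (Fin a) (Fin b) 𝕜 × Matrix (Fin c) (Fin d) 𝕜) :=
  Module.Finite.prod

theorem exists_posSemidef_mul_mul_self {κ : Type*} [Fintype κ] {P : Matrix κ κ 𝕜}
    (hP : P.PosSemidef) : ∃ H : Matrix κ κ 𝕜, H.PosSemidef ∧ P * H * P = P := by
  classical
  have hsa : IsSelfAdjoint P := hP.isHermitian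
  have hcont (f : ℝ → ℝ) : ContinuousOn f (spectrum ℝ P) :=
    (Matrix.finite_real_spectrum (A := P)).continuousOn f
  set G := cfc (fun x : ℝ => x⁻¹) P
  have hGsa : Gᴴ = G := cfc_predicate (fun x : ℝ => x⁻¹) P
  have hPGP : P * G * P = P := by
    calc P * G * P = cfc (fun x : ℝ => x * x⁻¹ * x) P := by
          rw [cfc_mul (fun x : ℝ => x * x⁻¹) (fun x => x) P (hcont _) (hcont _),
            cfc_mul (fun x : ℝ => x) (fun x => x⁻¹) P (hcont _) (hcont _), cfc_id' ℝ P]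
      _ = P := by simp only [mul_inv_mul_cancel, cfc_id' ℝ P]
  refine ⟨G * P * G, by simpa only [hGsa] using hP.mul_mul_conjTranspose_same G, ?_⟩
  calc P * (G * P * G) * P = P * G * P * G * P := by simp only [Matrix.mul_assoc]
    _ = P := by rw [hPGP, hPGP]

theorem mul_eq_zero_of_posSemidef_add {ι κ o : Type*} [Fintype ι] [Fintype κ] [Finite o]
    {P : Matrix κ κ 𝕜} (hP : P.PosSemidef) {Q : Matrix ι κ 𝕜} {X : Matrix κ o 𝕜} {ε : ℝ}
    (hε : 0 < ε) (h : (P + ε • (Qᴴ * Q)) * X = 0) : Q * X = 0 := by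
  have := Fintype.ofFinite o
  have hsum : Xᴴ * P * X + ε • ((Q * X)ᴴ * (Q * X)) = 0 := by
    calc Xᴴ * P * X + ε • ((Q * X)ᴴ * (Q * X)) = Xᴴ * ((P + ε • (Qᴴ * Q)) * X) := by
          simp [Matrix.mul_add, Matrix.add_mul, Matrix.mul_assoc]
      _ = 0 := by rw [h, Matrix.mul_zero]
  have htrace := congrArg Matrix.trace hsum
  rw [Matrix.trace_add, Matrix.trace_zero, add_eq_zero_iff_of_nonneg
    (hP.conjTranspose_mul_mul_same X).trace_nonneg
    ((Matrix.posSemidef_conjTranspose_mul_self (Q * X)).smul hε.le).trace_nonneg,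
    Matrix.trace_smul, smul_eq_zero_iff_right hε.ne',
    Matrix.trace_conjTranspose_mul_self_eq_zero_iff] at htrace
  exact htrace.2

theorem exists_posSemidef_eq_mul {ι κ : Type*} [Fintype ι] [Finite κ]
    {E Q : Matrix ι κ 𝕜} (hEQ : Eᴴ * Q = Qᴴ * E) (hpos : (Eᴴ * Q).PosSemidef) {ε : ℝ}
    (hε : 0 < ε) : ∃ T : Matrix ι ι 𝕜, T.PosSemidef ∧ Q = T * (E + ε • Q) := by
  classical
  have := Fintype.ofFinite κ
  set P := Eᴴ * Q + ε • (Qᴴ * Q) with hP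
  have hPpos : P.PosSemidef :=
    hpos.add ((Matrix.posSemidef_conjTranspose_mul_self Q).smul hε.le)
  obtain ⟨H, hH, hPHP⟩ := exists_posSemidef_mul_mul_self hPpos
  have hQHP : Q * (H * P - 1) = 0 := mul_eq_zero_of_posSemidef_add hpos hε <| by
    rw [← hP, Matrix.mul_sub, ← Matrix.mul_assoc, hPHP, Matrix.mul_one, sub_self]
  refine ⟨Q * H * Qᴴ, hH.mul_mul_conjTranspose_same Q, ?_⟩
  calc Q = Q * (H * P) := by rwa [Matrix.mul_sub, Matrix.mul_one, sub_eq_zero, eq_comm] at hQHP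
    _ = Q * H * Qᴴ * (E + ε • Q) := by
      rw [hP, hEQ, ← Matrix.mul_smul, ← Matrix.mul_add]
      simp only [Matrix.mul_assoc]

variable {ℓ n m : ℕ} {Y : Type*}

/-- The tuples `(E, y, Q, B)` with `y ∈ 𝒮` and `E*Q = Q*E ≥ 0`. Here `y` stands for the structure
matrices: `J` for `Σ^H`, and `(J, R)` for `Σ^sdH` and `Σ^dH`. -/
def phClass (𝕜 : Type*) [RCLike 𝕜] (ℓ n m : ℕ) (𝒮 : Set Y) :
    Set (Matrix (Fin ℓ) (Fin n) 𝕜 × Y × Matrix (Fin ℓ) (Fin n) 𝕜 × Matrix (Fin ℓ) (Fin m) 𝕜) :=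
  {x | x.2.1 ∈ 𝒮 ∧ x.1ᴴ * x.2.2.1 = x.2.2.1ᴴ * x.1 ∧ (x.1ᴴ * x.2.2.1).PosSemidef}

theorem mem_phClass_of_posSemidef {𝒮 : Set Y} {y : Y} (hy : y ∈ 𝒮) {T : Matrix (Fin ℓ) (Fin ℓ) 𝕜}
    (hT : T.PosSemidef) (E : Matrix (Fin ℓ) (Fin n) 𝕜) (B : Matrix (Fin ℓ) (Fin m) 𝕜) :
    (E, y, T * E, B) ∈ phClass 𝕜 ℓ n m 𝒮 := by
  refine ⟨hy, by rw [Matrix.conjTranspose_mul, hT.isHermitian.eq, Matrix.mul_assoc], ?_⟩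
  rw [← Matrix.mul_assoc]
  exact hT.conjTranspose_mul_mul_same E

theorem phClass_subset_closure_range [TopologicalSpace Y] (𝒮 : Set Y) :
    phClass 𝕜 ℓ n m 𝒮 ⊆ closure {x | ∃ E, ∃ y ∈ 𝒮, ∃ T : Matrix (Fin ℓ) (Fin ℓ) 𝕜, ∃ B,
      T.PosSemidef ∧ x = (E, y, T * E, B)} := by
  rintro ⟨E, y, Q, B⟩ ⟨hy, hEQ, hpos⟩
  have hcont : Continuous fun ε : ℝ => (E + ε • Q, y, Q, B) := by fun_prop
  refine mem_closure_of_tendsto ((hcont.tendsto' 0 _ (by simp)).mono_left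
    (nhdsWithin_le_nhds (s := Set.Ioi 0))) ?_
  filter_upwards [self_mem_nhdsWithin] with ε hε
  obtain ⟨T, hT, hQ⟩ := exists_posSemidef_eq_mul hEQ hpos hε
  exact ⟨E + ε • Q, y, hy, T, B, hT, by rw [← hQ]⟩

variable [AddCommGroup Y] [Module ℝ Y]

section Topology

variable [TopologicalSpace Y] [IsTopologicalAddGroup Y] [ContinuousSMul ℝ Y] [T2Space Y]
  [FiniteDimensional ℝ Y]

theorem phClass_subset_closure {𝒮 : Set Y} {y₁ : Y} (h𝒮 : ∀ y ∈ 𝒮, openSegment ℝ y y₁ ⊆ 𝒮)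
    {f : Matrix (Fin ℓ) (Fin n) 𝕜 × Y × Matrix (Fin ℓ) (Fin n) 𝕜 × Matrix (Fin ℓ) (Fin m) 𝕜 → ℝ}
    (hf : f ∈ polyFun _) {E₁ : Matrix (Fin ℓ) (Fin n) 𝕜} {B₁ : Matrix (Fin ℓ) (Fin m) 𝕜}
    (hf₁ : f (E₁, y₁, E₁, B₁) ≠ 0) :
    phClass 𝕜 ℓ n m 𝒮 ⊆ closure {x ∈ phClass 𝕜 ℓ n m 𝒮 | f x ≠ 0} := by
  refine (phClass_subset_closure_range 𝒮).trans (closure_minimal ?_ isClosed_closure)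
  rintro _ ⟨E, y, hy, T, B, hT, rfl⟩
  let γ (t : ℝ) := (AffineMap.lineMap E E₁ t, AffineMap.lineMap y y₁ t,
    AffineMap.lineMap T 1 t * AffineMap.lineMap E E₁ t, AffineMap.lineMap B B₁ t)
  have hγ : IsPolynomialMap γ :=
    (IsPolynomialMap.lineMap _ _).prodMk ((IsPolynomialMap.lineMap _ _).prodMk
      (((IsPolynomialMap.lineMap _ _).matrix_mul (IsPolynomialMap.lineMap _ _)).prodMk
        (IsPolynomialMap.lineMap _ _)))
  have hγ_mem : ∀ t ∈ Set.Ioo 0 1, γ t ∈ phClass 𝕜 ℓ n m 𝒮 := by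
    intro t ht
    refine mem_phClass_of_posSemidef (h𝒮 y hy ?_) ?_ _ _
    · exact openSegment_eq_image_lineMap ℝ y y₁ ▸ Set.mem_image_of_mem _ ht
    · rw [AffineMap.lineMap_apply_module]
      exact (hT.smul (sub_nonneg.2 ht.2.le)).add (Matrix.PosSemidef.one.smul ht.1.le)
  have hγ₀ := mem_closure_of_isPolynomialMap hf hγ hγ_mem (by simpa [γ] using hf₁)
  simpa [γ] using hγ₀

end Topology

/-- A condition on systems `[E, A, B]` is generic if it holds off the zero set of a polynomial that
does not vanish at some `[E₁, J₁ E₁, B₁]` with skew-Hermitian `J₁`, that is, at a system of `Σ^H`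
with `Q = E`. -/
def GenericCondition (P : Matrix (Fin ℓ) (Fin n) 𝕜 → Matrix (Fin ℓ) (Fin n) 𝕜 →
    Matrix (Fin ℓ) (Fin m) 𝕜 → Prop) : Prop :=
  ∃ f ∈ polyFun (Matrix (Fin ℓ) (Fin n) 𝕜 × Matrix (Fin ℓ) (Fin n) 𝕜 × Matrix (Fin ℓ) (Fin m) 𝕜),
    (∀ E A B, f (E, A, B) ≠ 0 → P E A B) ∧
      ∃ (E₁ : Matrix (Fin ℓ) (Fin n) 𝕜) (J₁ : Matrix (Fin ℓ) (Fin ℓ) 𝕜)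
        (B₁ : Matrix (Fin ℓ) (Fin m) 𝕜), J₁ = -J₁ᴴ ∧ f (E₁, J₁ * E₁, B₁) ≠ 0

variable {P P' : Matrix (Fin ℓ) (Fin n) 𝕜 → Matrix (Fin ℓ) (Fin n) 𝕜 →
  Matrix (Fin ℓ) (Fin m) 𝕜 → Prop}

theorem GenericCondition.mono (h : GenericCondition P) (hP : ∀ E A B, P E A B → P' E A B) :
    GenericCondition P' :=
  let ⟨f, hf, hfP, h₁⟩ := h
  ⟨f, hf, fun E A B hne => hP E A B (hfP E A B hne), h₁⟩

theorem genericCondition_injective {V Z : Type*} [AddCommGroup V] [Module 𝕜 V]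
    [FiniteDimensional 𝕜 V] [AddCommGroup Z] [Module 𝕜 Z]
    (Λ : (Matrix (Fin ℓ) (Fin n) 𝕜 × Matrix (Fin ℓ) (Fin n) 𝕜 × Matrix (Fin ℓ) (Fin m) 𝕜) →ₗ[𝕜]
      V →ₗ[𝕜] Z) {E₁ : Matrix (Fin ℓ) (Fin n) 𝕜} {J₁ : Matrix (Fin ℓ) (Fin ℓ) 𝕜}
    {B₁ : Matrix (Fin ℓ) (Fin m) 𝕜} (hJ₁ : J₁ = -J₁ᴴ)
    (h₁ : Function.Injective (Λ (E₁, J₁ * E₁, B₁))) :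
    GenericCondition fun E A B => Function.Injective (Λ (E, A, B)) := by
  obtain ⟨S, hS⟩ := LinearMap.exists_leftInverse_of_injective _ (LinearMap.ker_eq_bot.2 h₁)
  let b := Module.finBasis 𝕜 V
  let Θ := ((LinearMap.toMatrix b b).toLinearMap ∘ₗ S.compRight 𝕜 ∘ₗ Λ).restrictScalars ℝ
  refine ⟨_, (IsPolynomialMap.of_linearMap Θ).det.normSq_mem_polyFun, fun E A B hne => ?_,
    E₁, J₁, B₁, hJ₁, ?_⟩
  · have hdet : LinearMap.det (S ∘ₗ Λ (E, A, B)) ≠ 0 := by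
      rw [← LinearMap.det_toMatrix b]
      exact (map_ne_zero (RCLike.normSq (K := 𝕜))).1 hne
    have hinj := (LinearMap.equivOfDetNeZero _ hdet).injective
    exact Function.Injective.of_comp (f := S) hinj
  · refine (map_ne_zero (RCLike.normSq (K := 𝕜))).2 ?_
    change (LinearMap.toMatrix b b (S ∘ₗ Λ (E₁, J₁ * E₁, B₁))).det ≠ 0
    rw [hS, LinearMap.det_toMatrix, LinearMap.det_id]
    exact one_ne_zero

/-- Every skew-Hermitian `J` is `σ y₁` for some `y₁` towards which one can move inside `𝒮`. For
`Σ^sdH` and `Σ^dH`, where `σ (J, R) = J - R`, this takes `y₁ = (J, 0)`, which lies on the boundary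
of `𝒮` if `R > 0` is required. -/
def SkewAccessible (σ : Y →ₗ[ℝ] Matrix (Fin ℓ) (Fin ℓ) 𝕜) (𝒮 : Set Y) : Prop :=
  ∀ J : Matrix (Fin ℓ) (Fin ℓ) 𝕜, J = -Jᴴ → ∃ y₁, σ y₁ = J ∧ ∀ y ∈ 𝒮, openSegment ℝ y y₁ ⊆ 𝒮

theorem GenericCondition.relGeneric_phClass [TopologicalSpace Y]
    [IsTopologicalAddGroup Y] [ContinuousSMul ℝ Y] [T2Space Y] [FiniteDimensional ℝ Y]
    {σ : Y →ₗ[ℝ] Matrix (Fin ℓ) (Fin ℓ) 𝕜} {𝒮 : Set Y} (h𝒮 : SkewAccessible σ 𝒮)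
    {S : Set (Matrix (Fin ℓ) (Fin n) 𝕜 × Y × Matrix (Fin ℓ) (Fin n) 𝕜 × Matrix (Fin ℓ) (Fin m) 𝕜)}
    (hP : GenericCondition P) (hS : ∀ E y Q B, (E, y, Q, B) ∈ phClass 𝕜 ℓ n m 𝒮 →
      P E (σ y * Q) B → (E, y, Q, B) ∈ S) :
    RelGeneric S (phClass 𝕜 ℓ n m 𝒮) := by
  obtain ⟨f, hf, hfP, E₁, J₁, B₁, hJ₁, hf₁⟩ := hP
  obtain ⟨y₁, rfl, hy₁⟩ := h𝒮 J₁ hJ₁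
  have hsys : IsPolynomialMap fun x : Matrix (Fin ℓ) (Fin n) 𝕜 × Y × Matrix (Fin ℓ) (Fin n) 𝕜 ×
      Matrix (Fin ℓ) (Fin m) 𝕜 => (x.1, σ x.2.1 * x.2.2.1, x.2.2.2) := by
    have hid := IsPolynomialMap.of_linearMap (LinearMap.id (R := ℝ)
      (M := Matrix (Fin ℓ) (Fin n) 𝕜 × Y × Matrix (Fin ℓ) (Fin n) 𝕜 × Matrix (Fin ℓ) (Fin m) 𝕜))
    exact hid.fst.prodMk ((((hid.snd.fst.linearMap_comp σ)).matrix_mul hid.snd.snd.fst).prodMk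
      hid.snd.snd.snd)
  have hg := hsys.comp_mem_polyFun hf
  exact relGeneric_of_polyFun hg (fun ⟨E, y, Q, B⟩ hx hne => hS E y Q B hx (hfP _ _ _ hne))
    (phClass_subset_closure hy₁ hg hf₁)

end Density

section AbsolutelyContinuous

theorem absolutelyContinuousOnInterval_lipschitz_comp {X Z : Type*} [PseudoMetricSpace X]
    [PseudoMetricSpace Z] {f : ℝ → X} {a b : ℝ} (hf : AbsolutelyContinuousOnInterval f a b)
    {K : NNReal} {g : X → Z} (hg : LipschitzWith K g) :
    AbsolutelyContinuousOnInterval (fun t => g (f t)) a b := by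
  rw [absolutelyContinuousOnInterval_iff] at hf ⊢
  intro ε hε
  obtain ⟨δ, hδ, h⟩ := hf (ε / (K + 1)) (by positivity)
  refine ⟨δ, hδ, fun I hI hlt => ?_⟩
  calc ∑ i ∈ Finset.range I.1, dist (g (f (I.2 i).1)) (g (f (I.2 i).2))
      ≤ ∑ i ∈ Finset.range I.1, (K + 1 : ℝ) * dist (f (I.2 i).1) (f (I.2 i).2) := by
        gcongr with i
        exact (hg.dist_le_mul _ _).trans (by gcongr; linarith)
    _ = (K + 1 : ℝ) * ∑ i ∈ Finset.range I.1, dist (f (I.2 i).1) (f (I.2 i).2) :=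
        (Finset.mul_sum _ _ _).symm
    _ < (K + 1 : ℝ) * (ε / (K + 1)) := by gcongr; exact h I hI hlt
    _ = ε := by field_simp

theorem absolutelyContinuousOnInterval_comp_of_uIoc_subset {X : Type*} [PseudoMetricSpace X]
    {f : ℝ → X} {g : ℝ → ℝ} (hf : ∀ a b, AbsolutelyContinuousOnInterval f a b)
    (hg : LipschitzWith 1 g) (hsub : ∀ s t, Set.uIoc (g s) (g t) ⊆ Set.uIoc s t) (a b : ℝ) :
    AbsolutelyContinuousOnInterval (fun t => f (g t)) a b := by
  obtain ⟨lo, hlo⟩ := (isCompact_uIcc (a := a) (b := b)).bddBelow_image hg.continuous.continuousOn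
  obtain ⟨hi, hhi⟩ := (isCompact_uIcc (a := a) (b := b)).bddAbove_image hg.continuous.continuousOn
  have hmem : ∀ t ∈ Set.uIcc a b, g t ∈ Set.uIcc lo hi := fun t ht =>
    Set.Icc_subset_uIcc ⟨hlo ⟨t, ht, rfl⟩, hhi ⟨t, ht, rfl⟩⟩
  have h := hf lo hi
  rw [absolutelyContinuousOnInterval_iff] at h ⊢
  intro ε hε
  obtain ⟨δ, hδ, h⟩ := h ε hε
  refine ⟨δ, hδ, fun I hI hlt => h (I.1, fun i => (g (I.2 i).1, g (I.2 i).2)) ⟨?_, ?_⟩ ?_⟩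
  · exact fun i hi => ⟨hmem _ (hI.1 i hi).1, hmem _ (hI.1 i hi).2⟩
  · exact fun i hi j hj hij => (hI.2 hi hj hij).mono (hsub _ _) (hsub _ _)
  · exact (Finset.sum_le_sum fun i _ => by simpa using hg.dist_le_mul _ _).trans_lt hlt

theorem absolutelyContinuousOnInterval_glue {F : Type*} [SeminormedAddCommGroup F]
    {f g : ℝ → F} (hf : ∀ a b, AbsolutelyContinuousOnInterval f a b)
    (hg : ∀ a b, AbsolutelyContinuousOnInterval g a b) {c : ℝ} (hc : f c = g c) (a b : ℝ) :
    AbsolutelyContinuousOnInterval (fun t => if t < c then f t else g t) a b := by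
  have hmin := absolutelyContinuousOnInterval_comp_of_uIoc_subset hf
    (LipschitzWith.id.min_const c) (fun s t x hx => by
      simp only [Set.mem_uIoc, id_eq] at hx ⊢
      grind) a b
  have hmax := absolutelyContinuousOnInterval_comp_of_uIoc_subset hg
    (LipschitzWith.id.max_const c) (fun s t x hx => by
      simp only [Set.mem_uIoc, id_eq] at hx ⊢
      grind) a b
  have hconst : AbsolutelyContinuousOnInterval (fun _ : ℝ => f c) a b :=
    (LipschitzWith.const (f c)).lipschitzOnWith.absolutelyContinuousOnInterval
  convert (hmin.add hmax).sub hconst using 1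
  ext t
  by_cases ht : t < c
  · simp [ht, min_eq_left ht.le, max_eq_right ht.le, hc]
  · simp [ht, min_eq_right (not_lt.1 ht), max_eq_left (not_lt.1 ht)]

variable {F : Type*} [NormedAddCommGroup F]

theorem locallyIntegrable_glue {f g : ℝ → F} (hf : MeasureTheory.LocallyIntegrable f)
    (hg : MeasureTheory.LocallyIntegrable g) (c : ℝ) :
    MeasureTheory.LocallyIntegrable (fun t => if t < c then f t else g t) := by
  have hsum : (fun t => if t < c then f t else g t) =
      (Set.Iio c).indicator f + (Set.Ici c).indicator g := by
    ext t
    by_cases ht : t < c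
    · simp [ht]
    · simp [ht, not_lt.1 ht]
  rw [hsum]
  exact (hf.indicator measurableSet_Iio).add (hg.indicator measurableSet_Ici)

variable [NormedSpace ℝ F]

theorem contDiff_one_of_hasDerivAt {f g : ℝ → F} (hf : ∀ t, HasDerivAt f (g t) t)
    (hg : Continuous g) : ContDiff ℝ 1 f := by
  refine contDiff_one_iff_deriv.2 ⟨fun t => (hf t).differentiableAt, ?_⟩
  rwa [show deriv f = g from funext fun t => (hf t).deriv]

theorem hasDerivAt_of_ae_of_continuous [CompleteSpace F] {f g : ℝ → F}
    (hf : ∀ a b, AbsolutelyContinuousOnInterval f a b) (hg : Continuous g)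
    (h : ∀ᵐ t, HasDerivAt f (g t) t) (t : ℝ) : HasDerivAt f (g t) t := by
  let I : ℝ → F := fun s => ∫ v in (0 : ℝ)..s, g v
  have hI : ∀ t, HasDerivAt I (g t) t := fun t => (hg.integral_hasStrictDerivAt 0 t).hasDerivAt
  have hconst : ∀ s, f s - I s = f 0 - I 0 := by
    intro s
    have hac : AbsolutelyContinuousOnInterval (f - I) 0 s :=
      (hf 0 s).sub (contDiff_one_of_hasDerivAt hI hg).contDiffOn.absolutelyContinuousOnInterval
    obtain ⟨C, hC⟩ := hac.const_of_ae_hasDerivAt_zero (by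
      filter_upwards [h] with t ht _
      simpa using ht.sub (hI t))
    exact (hC s (by simp)).trans (hC 0 (by simp)).symm
  have hf_eq : f = fun s => (f 0 - I 0) + I s := funext fun s => by rw [← hconst s, sub_add_cancel]
  rw [hf_eq]
  exact (hI t).const_add _

end AbsolutelyContinuous

section LinearControl

open NormedSpace

variable {V W : Type*} [NormedAddCommGroup V] [NormedSpace ℝ V] [NormedAddCommGroup W]
  [NormedSpace ℝ W]

theorem eq_zero_of_linear_ode (F : V →L[ℝ] V) {x : ℝ → V} (hx : ∀ t, HasDerivAt x (F (x t)) t)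
    {t₀ : ℝ} (h₀ : x t₀ = 0) : x = fun _ => 0 :=
  ODE_solution_unique_univ (v := fun _ => F) (s := fun _ => Set.univ) (t₀ := t₀)
    (fun _ => F.lipschitz.lipschitzOnWith) (fun t => ⟨hx t, trivial⟩)
    (fun t => ⟨by simpa using hasDerivAt_const t (0 : V), trivial⟩) h₀

/-- The solution of `x' = F x + g`, `x 0 = x₀` given by the variation of constants formula. -/
noncomputable def linearODESolution (F : V →L[ℝ] V) (g : ℝ → V) (x₀ : V) (t : ℝ) : V :=
  exp (t • F) (x₀ + ∫ s in (0 : ℝ)..t, exp (-s • F) (g s))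

@[simp] theorem linearODESolution_zero (F : V →L[ℝ] V) (g : ℝ → V) (x₀ : V) :
    linearODESolution F g x₀ 0 = x₀ := by
  simp [linearODESolution]

section Complete

variable [CompleteSpace V]

theorem exp_smul_apply_exp_neg_smul (F : V →L[ℝ] V) (t : ℝ) (v : V) :
    exp (t • F) (exp (-t • F) v) = v := by
  let : NormedAlgebra ℚ (V →L[ℝ] V) := .restrictScalars ℚ ℝ _
  rw [← mul_apply_eq_comp, neg_smul, ← exp_add_of_commute (Commute.neg_right rfl), add_neg_cancel,
    exp_zero, one_apply_eq_self]

theorem continuous_exp_neg_smul_apply (F : V →L[ℝ] V) {g : ℝ → V} (hg : Continuous g) :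
    Continuous fun s : ℝ => exp (-s • F) (g s) :=
  ((differentiable_exp_smul_const ℝ F).continuous.comp continuous_neg).clm_apply hg

theorem hasDerivAt_linearODESolution (F : V →L[ℝ] V) {g : ℝ → V} (hg : Continuous g) (x₀ : V)
    (t : ℝ) : HasDerivAt (linearODESolution F g x₀) (F (linearODESolution F g x₀ t) + g t) t := by
  have hint := ((continuous_exp_neg_smul_apply F hg).integral_hasStrictDerivAt 0 t).hasDerivAt
  have hprod := (hasDerivAt_exp_smul_const' (𝕂 := ℝ) F t).clm_apply (hint.const_add x₀)
  rwa [exp_smul_apply_exp_neg_smul] at hprod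

theorem apply_pow_eq_zero_of_apply_exp_eq_zero (F : V →L[ℝ] V) (ξ : V →L[ℝ] ℝ) {T : ℝ}
    (hT : 0 < T) (v : V) (h : ∀ s ∈ Set.Icc 0 T, ξ (exp (-s • F) v) = 0) (k : ℕ) :
    ξ ((F ^ k) v) = 0 := by
  suffices h : ∀ s ∈ Set.Icc 0 T, ξ (exp (-s • F) ((F ^ k) v)) = 0 by
    simpa [exp_zero] using h 0 ⟨le_rfl, hT.le⟩
  induction k with
  | zero => simpa only [pow_zero, one_apply_eq_self] using h
  | succ k ih =>
    intro s hs
    have hd : HasDerivAt (fun s : ℝ => ξ (exp (-s • F) ((F ^ k) v)))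
        (-ξ (exp (-s • F) ((F ^ (k + 1)) v))) s := by
      have hexp := ((hasDerivAt_exp_smul_const (𝕂 := ℝ) F (-s)).scomp s
        (hasDerivAt_neg s)).clm_apply (hasDerivAt_const s ((F ^ k) v))
      simpa [pow_succ', Function.comp_def] using ξ.hasFDerivAt.comp_hasDerivAt s hexp
    have hz : HasDerivWithinAt (fun s : ℝ => ξ (exp (-s • F) ((F ^ k) v))) 0 (Set.Icc 0 T) s :=
      (hasDerivWithinAt_const s _ (0 : ℝ)).congr ih (ih s hs)
    exact neg_eq_zero.1 ((uniqueDiffOn_Icc hT s hs).eq_deriv _ hd.hasDerivWithinAt hz)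

theorem exists_apply_integral_ne_zero (F : V →L[ℝ] V) (G : W →L[ℝ] V) (ξ : V →L[ℝ] ℝ) {s T : ℝ}
    (hT : 0 < T) (hs : s ∈ Set.Icc 0 T) {w : W} (h : ξ (exp (-s • F) (G w)) ≠ 0) :
    ∃ v : ℝ → W, Continuous v ∧ ξ (∫ s in (0 : ℝ)..T, exp (-s • F) (G (v s))) ≠ 0 := by
  let q : ℝ → ℝ := fun s => ξ (exp (-s • F) (G w))
  have hq : Continuous q := ξ.continuous.comp (continuous_exp_neg_smul_apply F continuous_const)
  have hv : Continuous fun s => q s • w := hq.smul continuous_const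
  have hsq : ∫ s in (0 : ℝ)..T, q s ^ 2 =
      ξ (∫ s in (0 : ℝ)..T, exp (-s • F) (G (q s • w))) := by
    have hcont : Continuous fun s => exp (-s • F) (G (q s • w)) :=
      continuous_exp_neg_smul_apply F (G.continuous.comp hv)
    rw [← ξ.intervalIntegral_comp_comm (hcont.intervalIntegrable 0 T)]
    simp [q, sq]
  exact ⟨_, hv, hsq ▸ (intervalIntegral.integral_pos hT (hq.pow 2).continuousOn
    (fun s _ => sq_nonneg (q s)) ⟨s, hs, sq_pos_of_ne_zero h⟩).ne'⟩

end Complete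

/-- The Kalman rank condition, in dual form, for the control system `x' = F x + G v`. -/
def KalmanCondition (F : V →L[ℝ] V) (G : W →L[ℝ] V) : Prop :=
  ∀ ξ : V →L[ℝ] ℝ, (∀ k w, ξ ((F ^ k) (G w)) = 0) → ξ = 0

variable [FiniteDimensional ℝ V] {F : V →L[ℝ] V} {G : W →L[ℝ] V}

theorem KalmanCondition.exists_integral_eq (h : KalmanCondition F G) {T : ℝ} (hT : 0 < T) (y : V) :
    ∃ v : ℝ → W, Continuous v ∧ ∫ s in (0 : ℝ)..T, exp (-s • F) (G (v s)) = y := by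
  have := FiniteDimensional.complete ℝ V
  have hint : ∀ v : ℝ → W, Continuous v →
      IntervalIntegrable (fun s => exp (-s • F) (G (v s))) MeasureTheory.volume 0 T := fun v hv =>
    (continuous_exp_neg_smul_apply F (G.continuous.comp hv)).intervalIntegrable 0 T
  let reachable : Submodule ℝ V :=
    { carrier := {y | ∃ v : ℝ → W, Continuous v ∧ ∫ s in (0 : ℝ)..T, exp (-s • F) (G (v s)) = y}
      zero_mem' := ⟨0, continuous_zero, by simp⟩
      add_mem' := by
        rintro _ _ ⟨v, hv, rfl⟩ ⟨v', hv', rfl⟩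
        refine ⟨v + v', hv.add hv', ?_⟩
        simpa using intervalIntegral.integral_add (hint v hv) (hint v' hv')
      smul_mem' := by
        rintro c _ ⟨v, hv, rfl⟩
        exact ⟨c • v, hv.const_smul c, by simp⟩ }
  suffices htop : reachable = ⊤ from (Submodule.eq_top_iff'.1 htop) y
  by_contra hne
  obtain ⟨ξ, hξ, hker⟩ := reachable.exists_dual_map_eq_bot_of_lt_top (lt_top_iff_ne_top.2 hne)
    inferInstance
  refine hξ (congrArg ContinuousLinearMap.toLinearMap (h ξ.toContinuousLinearMap fun k w =>
    apply_pow_eq_zero_of_apply_exp_eq_zero F _ hT (G w) (fun s hs => ?_) k))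
  by_contra hs0
  obtain ⟨v, hv, hne⟩ := exists_apply_integral_ne_zero F G _ hT hs hs0
  exact hne ((Submodule.mem_bot ℝ).1 (hker ▸ Submodule.mem_map_of_mem ⟨v, hv, rfl⟩))

theorem KalmanCondition.exists_steering (h : KalmanCondition F G) {T : ℝ} (hT : 0 < T)
    (x₀ x₁ : V) : ∃ v : ℝ → W, Continuous v ∧ ∃ x : ℝ → V,
      (∀ t, HasDerivAt x (F (x t) + G (v t)) t) ∧ x 0 = x₀ ∧ x T = x₁ := by
  have := FiniteDimensional.complete ℝ V
  obtain ⟨v, hv, hvT⟩ := h.exists_integral_eq hT (exp (-T • F) x₁ - x₀)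
  refine ⟨v, hv, linearODESolution F (fun t => G (v t)) x₀,
    hasDerivAt_linearODESolution F (G.continuous.comp hv) x₀, linearODESolution_zero _ _ _, ?_⟩
  rw [linearODESolution, hvT, add_sub_cancel, exp_smul_apply_exp_neg_smul]

end LinearControl

section Trajectories

variable {𝕜 : Type*} [RCLike 𝕜]

/-- A `𝕜`-linear map viewed as a continuous `ℝ`-linear map, for use in real differentiation. -/
noncomputable def realCLM {F G : Type*} [NormedAddCommGroup F] [NormedSpace ℝ F] [NormedSpace 𝕜 F]
    [FiniteDimensional ℝ F] [NormedAddCommGroup G] [NormedSpace ℝ G] [NormedSpace 𝕜 G]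
    [LinearMap.CompatibleSMul F G ℝ 𝕜] (L : F →ₗ[𝕜] G) : F →L[ℝ] G :=
  LinearMap.toContinuousLinearMap (L.restrictScalars ℝ)

@[simp] theorem realCLM_apply {F G : Type*} [NormedAddCommGroup F] [NormedSpace ℝ F]
    [NormedSpace 𝕜 F] [FiniteDimensional ℝ F] [NormedAddCommGroup G] [NormedSpace ℝ G]
    [NormedSpace 𝕜 G] [LinearMap.CompatibleSMul F G ℝ 𝕜] (L : F →ₗ[𝕜] G) (x : F) :
    realCLM L x = L x := rfl

theorem realCLM_pow {F : Type*} [NormedAddCommGroup F] [NormedSpace ℝ F] [NormedSpace 𝕜 F]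
    [FiniteDimensional ℝ F] [LinearMap.CompatibleSMul F F ℝ 𝕜] (L : F →ₗ[𝕜] F) (k : ℕ) :
    realCLM L ^ k = realCLM (L ^ k) := by
  induction k with
  | zero => rfl
  | succ k ih => rw [pow_succ, ih, pow_succ]; rfl

variable {ℓ n m : ℕ} {E A : Matrix (Fin ℓ) (Fin n) 𝕜} {B : Matrix (Fin ℓ) (Fin m) 𝕜}
  {w w₁ w₂ : (ℝ → Fin n → 𝕜) × (ℝ → Fin m → 𝕜)}

theorem hasDerivAt_mulVec (E : Matrix (Fin ℓ) (Fin n) 𝕜) {x : ℝ → Fin n → 𝕜} {v : Fin n → 𝕜}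
    {t : ℝ} (hx : HasDerivAt x v t) : HasDerivAt (fun s => E *ᵥ x s) (E *ᵥ v) t :=
  (realCLM E.mulVecLin).hasFDerivAt.comp_hasDerivAt t hx

theorem mem_behaviour_of_hasDerivAt {x v : ℝ → Fin n → 𝕜} {u : ℝ → Fin m → 𝕜}
    (hx : ∀ t, HasDerivAt x (v t) t) (hv : Continuous v) (hu : Continuous u)
    (h : ∀ t, E *ᵥ v t = A *ᵥ x t + B *ᵥ u t) : (x, u) ∈ behaviour E A B := by
  have hEx := fun t => hasDerivAt_mulVec E (hx t)
  have hEv : Continuous fun t => E *ᵥ v t := (realCLM E.mulVecLin).continuous.comp hv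
  exact ⟨(continuous_iff_continuousAt.2 fun t => (hx t).continuousAt).locallyIntegrable,
    hu.locallyIntegrable,
    fun a b => (contDiff_one_of_hasDerivAt hEx hEv).contDiffOn.absolutelyContinuousOnInterval,
    .of_forall fun t => h t ▸ hEx t⟩

theorem zero_mem_behaviour : ((fun _ => 0, fun _ => 0) : (ℝ → Fin n → 𝕜) × (ℝ → Fin m → 𝕜)) ∈
    behaviour E A B :=
  mem_behaviour_of_hasDerivAt (v := fun _ => 0) (fun t => hasDerivAt_const t 0) continuous_const
    continuous_const (by simp)

theorem glue_mem_behaviour (h₁ : w₁ ∈ behaviour E A B) (h₂ : w₂ ∈ behaviour E A B) {c : ℝ}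
    (hc : E *ᵥ w₁.1 c = E *ᵥ w₂.1 c) :
    ((fun t => if t < c then w₁.1 t else w₂.1 t, fun t => if t < c then w₁.2 t else w₂.2 t) :
      (ℝ → Fin n → 𝕜) × (ℝ → Fin m → 𝕜)) ∈ behaviour E A B := by
  obtain ⟨hx₁, hu₁, hac₁, hd₁⟩ := h₁
  obtain ⟨hx₂, hu₂, hac₂, hd₂⟩ := h₂
  refine ⟨locallyIntegrable_glue hx₁ hx₂ c, locallyIntegrable_glue hu₁ hu₂ c, ?_, ?_⟩
  · simp only [apply_ite (E *ᵥ ·)]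
    exact absolutelyContinuousOnInterval_glue hac₁ hac₂ hc
  · filter_upwards [hd₁, hd₂, MeasureTheory.Measure.ae_ne MeasureTheory.volume c] with t h₁ h₂ hne
    rcases lt_or_gt_of_ne hne with h | h
    · simp only [h, if_true]
      refine h₁.congr_of_eventuallyEq ?_
      filter_upwards [Iio_mem_nhds h] with s hs
      simp [Set.mem_Iio.1 hs]
    · simp only [not_lt.2 h.le, if_false]
      refine h₂.congr_of_eventuallyEq ?_
      filter_upwards [Ioi_mem_nhds h] with s hs
      simp [not_lt.2 (Set.mem_Ioi.1 hs).le]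

theorem StronglyControllable.behaviourallyControllable (h : StronglyControllable E A B) :
    BehaviourallyControllable E A B := by
  obtain ⟨T, hT, h⟩ := h
  intro w₁ hw₁ w₂ hw₂
  obtain ⟨w, hw, h₀, h_T⟩ := h (w₁.1 0) (w₂.1 T)
  refine ⟨T, hT, _, glue_mem_behaviour (c := T) (glue_mem_behaviour (c := 0) hw₁ hw h₀.symm) hw₂ ?_,
    fun t ht => ?_, fun t ht => ?_⟩
  · simp [not_lt.2 hT.le, h_T]
  · simp [ht, ht.trans hT]
  · simp [not_lt.2 (le_of_lt ht)]

theorem CompletelyControllable.stronglyControllable (h : CompletelyControllable E A B) :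
    StronglyControllable E A B := by
  obtain ⟨T, hT, h⟩ := h
  refine ⟨T, hT, fun x₀ x_T => ?_⟩
  obtain ⟨w, hw, h₀, h_T⟩ := h x₀ x_T
  exact ⟨w, hw, by rw [h₀.2], by rw [h_T.2]⟩

theorem CompletelyControllable.freelyInitializable (h : CompletelyControllable E A B) :
    FreelyInitializable E A B := by
  obtain ⟨T, -, h⟩ := h
  intro x₀
  obtain ⟨w, hw, h₀, -⟩ := h x₀ x₀
  exact ⟨w, hw, h₀⟩

theorem FreelyInitializable.impulseControllable (h : FreelyInitializable E A B) :
    ImpulseControllable E A B := by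
  intro x₀
  obtain ⟨w, hw, h₀⟩ := h x₀
  exact ⟨w, hw, by rw [h₀.2]⟩

/-- The map `(v, u) ↦ E v - B u`: the equation `E x' = A x + B u` reads
`inputMap E B (x', u) = A x`. -/
def inputMap (E : Matrix (Fin ℓ) (Fin n) 𝕜) (B : Matrix (Fin ℓ) (Fin m) 𝕜) :
    (Fin n → 𝕜) × (Fin m → 𝕜) →ₗ[𝕜] (Fin ℓ → 𝕜) :=
  E.mulVecLin.coprod (-B.mulVecLin)

@[simp] theorem inputMap_apply (p : (Fin n → 𝕜) × (Fin m → 𝕜)) :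
    inputMap E B p = E *ᵥ p.1 - B *ᵥ p.2 := by
  simp [inputMap, sub_eq_add_neg]

theorem mulVec_injective_of_inputMap_injective (h : Function.Injective (inputMap E B)) :
    Function.Injective (E *ᵥ ·) := fun v v' hv =>
  congrArg Prod.fst (@h (v, 0) (v', 0) (by simpa using hv))

section RightInverse

variable {R : (Fin ℓ → 𝕜) →ₗ[𝕜] (Fin n → 𝕜) × (Fin m → 𝕜)}

theorem mem_behaviour_of_rightInverse (hR : Function.RightInverse R (inputMap E B))
    {x : ℝ → Fin n → 𝕜} {k : ℝ → (Fin n → 𝕜) × (Fin m → 𝕜)} (hk : Continuous k)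
    (hker : ∀ t, inputMap E B (k t) = 0) (hx : ∀ t, HasDerivAt x (R (A *ᵥ x t) + k t).1 t) :
    (x, fun t => (R (A *ᵥ x t) + k t).2) ∈ behaviour E A B := by
  have hxc : Continuous x := continuous_iff_continuousAt.2 fun t => (hx t).continuousAt
  have hRk : Continuous fun t => R (A *ᵥ x t) + k t :=
    ((realCLM (R ∘ₗ A.mulVecLin)).continuous.comp hxc).add hk
  refine mem_behaviour_of_hasDerivAt hx hRk.fst hRk.snd fun t => ?_
  rw [← sub_eq_iff_eq_add, ← inputMap_apply, map_add, hR, hker, add_zero]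

theorem freelyInitializable_of_inputMap_surjective (h : Function.Surjective (inputMap E B)) :
    FreelyInitializable E A B := by
  intro x₀
  obtain ⟨R, hR⟩ := (inputMap E B).exists_rightInverse_of_surjective (LinearMap.range_eq_top.2 h)
  let F := realCLM (LinearMap.fst 𝕜 _ _ ∘ₗ R ∘ₗ A.mulVecLin)
  obtain ⟨x, hx₀, hx⟩ : ∃ x : ℝ → Fin n → 𝕜, x 0 = x₀ ∧ ∀ t, HasDerivAt x (F (x t)) t :=
    ⟨_, linearODESolution_zero F 0 x₀, fun t => by
      simpa using hasDerivAt_linearODESolution F continuous_zero x₀ t⟩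
  exact ⟨_, mem_behaviour_of_rightInverse (LinearMap.congr_fun hR) (k := fun _ => 0)
    continuous_const (by simp) (by simpa [F] using hx), (hx 0).continuousAt, hx₀⟩

end RightInverse

section LeftInverse

variable {L : (Fin ℓ → 𝕜) →ₗ[𝕜] (Fin n → 𝕜) × (Fin m → 𝕜)}

theorem fst_leftInverse_mulVec (hL : Function.LeftInverse L (inputMap E B)) (v : Fin n → 𝕜) :
    (L (E *ᵥ v)).1 = v := by
  simpa using congrArg Prod.fst (hL (v, 0))

theorem absolutelyContinuous_of_mem_behaviour (h : Function.Injective (inputMap E B))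
    (hw : w ∈ behaviour E A B) (a b : ℝ) : AbsolutelyContinuousOnInterval w.1 a b := by
  obtain ⟨L, hL⟩ := (inputMap E B).exists_leftInverse_of_injective (LinearMap.ker_eq_bot.2 h)
  have := absolutelyContinuousOnInterval_lipschitz_comp (hw.2.2.1 a b)
    (realCLM (LinearMap.fst 𝕜 _ _ ∘ₗ L)).lipschitz
  simpa [fst_leftInverse_mulVec (LinearMap.congr_fun hL)] using this

theorem continuous_of_mem_behaviour (h : Function.Injective (inputMap E B))
    (hw : w ∈ behaviour E A B) : Continuous w.1 :=
  continuous_iff_continuousAt.2 fun t =>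
    (absolutelyContinuous_of_mem_behaviour h hw (t - 1) (t + 1)).continuousOn.continuousAt (by
      rw [Set.uIcc_of_le (by linarith)]
      exact Icc_mem_nhds (by linarith) (by linarith))

theorem ae_hasDerivAt_of_mem_behaviour (hL : Function.LeftInverse L (inputMap E B))
    (hw : w ∈ behaviour E A B) : ∀ᵐ t, HasDerivAt w.1 (L (A *ᵥ w.1 t)).1 t ∧
      inputMap E B (L (A *ᵥ w.1 t)) = A *ᵥ w.1 t := by
  filter_upwards [hw.2.2.2] with t ht
  obtain ⟨v, hv⟩ : ∃ v, HasDerivAt w.1 v t := by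
    have hx := (realCLM (LinearMap.fst 𝕜 _ _ ∘ₗ L)).hasFDerivAt.comp_hasDerivAt t ht
    simp only [Function.comp_def, realCLM_apply, LinearMap.comp_apply, LinearMap.fst_apply,
      fst_leftInverse_mulVec hL] at hx
    exact ⟨_, hx⟩
  have hEv : inputMap E B (v, w.2 t) = A *ᵥ w.1 t := by
    rw [inputMap_apply, (hasDerivAt_mulVec E hv).unique ht, add_sub_cancel_right]
  rw [← hEv, hL]
  exact ⟨hv, rfl⟩

theorem hasDerivAt_of_mem_behaviour (hL : Function.LeftInverse L (inputMap E B))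
    (hw : w ∈ behaviour E A B) (t : ℝ) : HasDerivAt w.1 (L (A *ᵥ w.1 t)).1 t := by
  have hx : Continuous fun t => (L (A *ᵥ w.1 t)).1 :=
    (realCLM (LinearMap.fst 𝕜 _ _ ∘ₗ L ∘ₗ A.mulVecLin)).continuous.comp
      (continuous_of_mem_behaviour hL.injective hw)
  have hac : ∀ a b, AbsolutelyContinuousOnInterval w.1 a b :=
    absolutelyContinuous_of_mem_behaviour hL.injective hw
  exact hasDerivAt_of_ae_of_continuous hac hx
    ((ae_hasDerivAt_of_mem_behaviour hL hw).mono fun _ h => h.1) t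

theorem inputMap_leftInverse_of_mem_behaviour (hL : Function.LeftInverse L (inputMap E B))
    (hw : w ∈ behaviour E A B) (t : ℝ) : inputMap E B (L (A *ᵥ w.1 t)) = A *ᵥ w.1 t := by
  have hx := continuous_of_mem_behaviour hL.injective hw
  exact congrFun ((Continuous.ae_eq_iff_eq MeasureTheory.volume
    ((realCLM (inputMap E B ∘ₗ L ∘ₗ A.mulVecLin)).continuous.comp hx)
    ((realCLM A.mulVecLin).continuous.comp hx)).1
      ((ae_hasDerivAt_of_mem_behaviour hL hw).mono fun _ h => h.2)) t

theorem eq_zero_of_mem_behaviour (h : Function.Injective (inputMap E B))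
    (hw : w ∈ behaviour E A B) {t₀ : ℝ} (h₀ : w.1 t₀ = 0) : w.1 = fun _ => 0 := by
  obtain ⟨L, hL⟩ := (inputMap E B).exists_leftInverse_of_injective (LinearMap.ker_eq_bot.2 h)
  exact eq_zero_of_linear_ode (realCLM (LinearMap.fst 𝕜 _ _ ∘ₗ L ∘ₗ A.mulVecLin))
    (hasDerivAt_of_mem_behaviour (LinearMap.congr_fun hL) hw) h₀

theorem not_stronglyControllable_of_inputMap_injective (hn : 0 < n)
    (h : Function.Injective (inputMap E B)) : ¬ StronglyControllable E A B := by
  rintro ⟨T, -, hs⟩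
  obtain ⟨w, hw, h₀, h_T⟩ := hs 0 (fun _ => 1)
  have h₀ := mulVec_injective_of_inputMap_injective h h₀
  have h_T := mulVec_injective_of_inputMap_injective h h_T
  rw [eq_zero_of_mem_behaviour h hw h₀] at h_T
  exact zero_ne_one (congrFun h_T ⟨0, hn⟩)

theorem not_behaviourallyControllable_of_inputMap_bijective (hn : 0 < n)
    (h : Function.Bijective (inputMap E B)) : ¬ BehaviourallyControllable E A B := by
  intro hb
  obtain ⟨w₂, hw₂, -, h₀⟩ := freelyInitializable_of_inputMap_surjective (A := A) h.2 (fun _ => 1)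
  obtain ⟨T, -, w, hw, hneg, hpos⟩ := hb _ zero_mem_behaviour _ hw₂
  have hw_zero := eq_zero_of_mem_behaviour h.1 hw (hneg (-1) (by norm_num)).1
  have hw₂T := (hpos (T + 1) (by simp)).1
  rw [hw_zero] at hw₂T
  rw [eq_zero_of_mem_behaviour h.1 hw₂ hw₂T.symm] at h₀
  exact zero_ne_one (congrFun h₀ ⟨0, hn⟩)

end LeftInverse

end Trajectories

section Arrays

variable {𝕜 : Type*} [RCLike 𝕜] {ℓ n m : ℕ}

/-- The first `N` time derivatives of `E x' = A x + B u`, as a linear map in the derivatives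
`x₀, …, x_N` of `x` and `u₀, …, u_{N-1}` of `u`. -/
def derivArray (N : ℕ) : (Matrix (Fin ℓ) (Fin n) 𝕜 × Matrix (Fin ℓ) (Fin n) 𝕜 ×
    Matrix (Fin ℓ) (Fin m) 𝕜) →ₗ[𝕜]
    ((Fin (N + 1) → Fin n → 𝕜) × (Fin N → Fin m → 𝕜)) →ₗ[𝕜] (Fin N → Fin ℓ → 𝕜) :=
  LinearMap.mk₂ 𝕜 (fun p y s => p.1 *ᵥ y.1 s.succ - (p.2.1 *ᵥ y.1 s.castSucc + p.2.2 *ᵥ y.2 s))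
    (fun p q y => funext fun s => by
      simp only [Prod.fst_add, Prod.snd_add, Matrix.add_mulVec, Pi.add_apply]
      abel)
    (fun c p y => funext fun s => by
      simp only [Prod.smul_fst, Prod.smul_snd, Matrix.smul_mulVec, Pi.smul_apply, smul_sub,
        smul_add])
    (fun p y z => funext fun s => by
      simp only [Prod.fst_add, Prod.snd_add, Matrix.mulVec_add, Pi.add_apply]
      abel)
    (fun c p y => funext fun s => by
      simp only [Prod.smul_fst, Prod.smul_snd, Matrix.mulVec_smul, Pi.smul_apply, smul_sub,
        smul_add])

/-- The transposed array: a linear map in row vectors `μ₀, …, μ_N` whose kernel consists of the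
chains `μ_{s+1} E = μ_s A` of row vectors that annihilate `B`. -/
def dualArray (N : ℕ) : (Matrix (Fin ℓ) (Fin n) 𝕜 × Matrix (Fin ℓ) (Fin n) 𝕜 ×
    Matrix (Fin ℓ) (Fin m) 𝕜) →ₗ[𝕜]
    (Fin (N + 1) → Fin ℓ → 𝕜) →ₗ[𝕜] (Fin N → Fin n → 𝕜) × (Fin (N + 1) → Fin m → 𝕜) :=
  LinearMap.mk₂ 𝕜
    (fun p μ => (fun s => μ s.succ ᵥ* p.1 - μ s.castSucc ᵥ* p.2.1, fun s => μ s ᵥ* p.2.2))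
    (fun p q μ => Prod.ext (funext fun s => by
        simp only [Prod.fst_add, Prod.snd_add, Matrix.vecMul_add, Pi.add_apply]
        abel)
      (funext fun s => by simp only [Prod.snd_add, Matrix.vecMul_add, Pi.add_apply]))
    (fun c p μ => Prod.ext (funext fun s => by
        simp only [Prod.smul_fst, Prod.smul_snd, Matrix.vecMul_smul, Pi.smul_apply, smul_sub])
      (funext fun s => by simp only [Prod.smul_snd, Matrix.vecMul_smul, Pi.smul_apply]))
    (fun p μ ν => Prod.ext (funext fun s => by
        simp only [Prod.fst_add, Matrix.add_vecMul, Pi.add_apply]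
        abel)
      (funext fun s => by simp only [Prod.snd_add, Matrix.add_vecMul, Pi.add_apply]))
    (fun c p μ => Prod.ext (funext fun s => by
        simp only [Prod.smul_fst, Matrix.smul_vecMul, Pi.smul_apply, smul_sub])
      (funext fun s => by simp only [Prod.smul_snd, Matrix.smul_vecMul, Pi.smul_apply]))

variable {E A : Matrix (Fin ℓ) (Fin n) 𝕜} {B : Matrix (Fin ℓ) (Fin m) 𝕜} {N : ℕ}

theorem derivArray_injective_iff : Function.Injective (derivArray N (E, A, B)) ↔
    ∀ (x : ℕ → Fin n → 𝕜) (u : ℕ → Fin m → 𝕜),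
      (∀ s < N, E *ᵥ x (s + 1) = A *ᵥ x s + B *ᵥ u s) →
      (∀ s ≤ N, x s = 0) ∧ ∀ s < N, u s = 0 := by
  rw [injective_iff_map_eq_zero]
  constructor
  · intro h x u hxu
    have h0 := h (fun s => x s, fun s => u s) (funext fun s => sub_eq_zero.2 (hxu s s.2))
    exact ⟨fun s hs => congrFun (congrArg Prod.fst h0) ⟨s, by omega⟩,
      fun s hs => congrFun (congrArg Prod.snd h0) ⟨s, hs⟩⟩
  · rintro h ⟨x, u⟩ hxu
    have h0 := h (fun s => if hs : s < N + 1 then x ⟨s, hs⟩ else 0)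
      (fun s => if hs : s < N then u ⟨s, hs⟩ else 0) fun s hs => by
        simpa [hs, hs.trans (Nat.lt_succ_self N)] using sub_eq_zero.1 (congrFun hxu ⟨s, hs⟩)
    refine Prod.ext (funext fun s => ?_) (funext fun s => ?_)
    · simpa [s.is_le] using h0.1 s s.is_le
    · simpa using h0.2 s s.2

theorem dualArray_injective_iff : Function.Injective (dualArray N (E, A, B)) ↔
    ∀ μ : ℕ → Fin ℓ → 𝕜, (∀ s < N, μ (s + 1) ᵥ* E = μ s ᵥ* A) → (∀ s ≤ N, μ s ᵥ* B = 0) →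
      ∀ s ≤ N, μ s = 0 := by
  rw [injective_iff_map_eq_zero]
  constructor
  · intro h μ hEA hB s hs
    exact congrFun (h (fun s => μ s) (Prod.ext (funext fun s => sub_eq_zero.2 (hEA s s.2))
      (funext fun s => hB s (by omega)))) ⟨s, by omega⟩
  · intro h μ hμ
    have h0 := h (fun s => if hs : s < N + 1 then μ ⟨s, hs⟩ else 0)
      (fun s hs => by
        simpa [hs, hs.trans (Nat.lt_succ_self N)] using
          sub_eq_zero.1 (congrFun (congrArg Prod.fst hμ) ⟨s, hs⟩))
      (fun s hs => by
        have hB : μ ⟨s, Nat.lt_succ_of_le hs⟩ ᵥ* B = 0 := congrFun (congrArg Prod.snd hμ) _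
        simpa [Nat.lt_succ_of_le hs] using hB)
    exact funext fun s => by simpa [s.is_le] using h0 s s.is_le

section Overdetermined

theorem inputMap_injective_of_derivArray_injective (hN : 0 < N)
    (h : Function.Injective (derivArray N (E, A, B))) : Function.Injective (inputMap E B) := by
  obtain ⟨M, rfl⟩ : ∃ M, N = M + 1 := ⟨N - 1, by omega⟩
  refine (injective_iff_map_eq_zero _).2 fun p hp => ?_
  have h0 := derivArray_injective_iff.1 h (Pi.single (M + 1) p.1) (Pi.single M p.2) fun s hs => by
    rw [Pi.single_eq_of_ne (i := M + 1) (i' := s) (by omega), Matrix.mulVec_zero, zero_add]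
    rcases eq_or_ne s M with rfl | hsM
    · simpa [sub_eq_zero] using hp
    · simp [hsM]
  exact Prod.ext (by simpa using h0.1 (M + 1) le_rfl) (by simpa using h0.2 M (Nat.lt_succ_self M))

theorem fst_eq_zero_of_mem_behaviour (hN : 0 < N)
    (h : Function.Injective (derivArray N (E, A, B)))
    {w : (ℝ → Fin n → 𝕜) × (ℝ → Fin m → 𝕜)} (hw : w ∈ behaviour E A B) (t : ℝ) : w.1 t = 0 := by
  obtain ⟨L, hL⟩ := (inputMap E B).exists_leftInverse_of_injective
    (LinearMap.ker_eq_bot.2 (inputMap_injective_of_derivArray_injective hN h))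
  have hd := hasDerivAt_of_mem_behaviour (LinearMap.congr_fun hL) hw
  let F : (Fin n → 𝕜) →ₗ[𝕜] (Fin n → 𝕜) := LinearMap.fst 𝕜 _ _ ∘ₗ L ∘ₗ A.mulVecLin
  -- The constraint `inputMap E B (L (A x)) = A x` is preserved by differentiation along `x' = F x`.
  let M : (Fin n → 𝕜) →ₗ[𝕜] (Fin ℓ → 𝕜) := inputMap E B ∘ₗ L ∘ₗ A.mulVecLin - A.mulVecLin
  have hM : ∀ i t, M ((F ^ i) (w.1 t)) = 0 := by
    intro i
    induction i with
    | zero =>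
      exact fun t => sub_eq_zero.2
        (inputMap_leftInverse_of_mem_behaviour (LinearMap.congr_fun hL) hw t)
    | succ i ih =>
      intro t
      have hderiv := (realCLM (M ∘ₗ (F ^ i))).hasFDerivAt.comp_hasDerivAt t (hd t)
      have hconst : realCLM (M ∘ₗ (F ^ i)) ∘ w.1 = fun _ => 0 := funext ih
      rw [hconst] at hderiv
      rw [pow_succ]
      exact hderiv.unique (hasDerivAt_const t 0)
  have h0 := derivArray_injective_iff.1 h (fun s => (F ^ s) (w.1 t))
    (fun s => (L (A *ᵥ (F ^ s) (w.1 t))).2) fun s _ => by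
      rw [pow_succ', ← sub_eq_iff_eq_add]
      simpa [M, F, sub_eq_zero] using hM s t
  simpa using h0.1 0 (Nat.zero_le N)

theorem not_impulseControllable_of_derivArray_injective (hn : 0 < n) (hN : 0 < N)
    (h : Function.Injective (derivArray N (E, A, B))) : ¬ ImpulseControllable E A B := by
  intro hI
  obtain ⟨w, hw, h₀⟩ := hI (fun _ => 1)
  have h₁ := mulVec_injective_of_inputMap_injective
    (inputMap_injective_of_derivArray_injective hN h) h₀
  rw [fst_eq_zero_of_mem_behaviour hN h hw] at h₁
  exact zero_ne_one (congrFun h₁ ⟨0, hn⟩)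

theorem behaviourallyControllable_of_derivArray_injective (hN : 0 < N)
    (h : Function.Injective (derivArray N (E, A, B))) : BehaviourallyControllable E A B := by
  intro w₁ hw₁ w₂ hw₂
  refine ⟨1, one_pos, _, glue_mem_behaviour (c := 0) hw₁ hw₂ ?_, fun t ht => ?_, fun t ht => ?_⟩
  · rw [fst_eq_zero_of_mem_behaviour hN h hw₁, fst_eq_zero_of_mem_behaviour hN h hw₂]
  · simp [ht]
  · simp [(one_pos.trans ht).not_gt]

end Overdetermined

section Underdetermined

theorem inputMap_surjective_of_dualArray_injective
    (h : Function.Injective (dualArray N (E, A, B))) : Function.Surjective (inputMap E B) := by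
  rw [← LinearMap.range_eq_top]
  by_contra hne
  obtain ⟨ξ, hξ, hker⟩ := Submodule.exists_dual_map_eq_bot_of_lt_top (lt_top_iff_ne_top.2 hne)
    inferInstance
  obtain ⟨ν, rfl⟩ := (dotProductEquiv 𝕜 (Fin ℓ)).surjective ξ
  have hν : ∀ p, ν ⬝ᵥ inputMap E B p = 0 := fun p =>
    (Submodule.mem_bot 𝕜).1 (hker ▸ Submodule.mem_map_of_mem (LinearMap.mem_range_self _ p))
  have hE : ν ᵥ* E = 0 := dotProduct_eq_zero_iff.1 fun v => by
    simpa [Matrix.dotProduct_mulVec] using hν (v, 0)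
  have hB : ν ᵥ* B = 0 := dotProduct_eq_zero_iff.1 fun v => by
    simpa [Matrix.dotProduct_mulVec] using hν (0, v)
  have h0 := dualArray_injective_iff.1 h (Pi.single N ν)
    (fun s hs => by
      rw [Pi.single_eq_of_ne (i := N) (i' := s) hs.ne, Matrix.zero_vecMul]
      rcases eq_or_ne (s + 1) N with rfl | hsN
      · simpa using hE
      · simp [hsN])
    (fun s hs => by
      rcases eq_or_ne s N with rfl | hsN
      · simpa using hB
      · simp [hsN]) N le_rfl
  refine hξ ?_
  simpa using h0

theorem exists_vecMul_chain_of_rightInverse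
    {R : (Fin ℓ → 𝕜) →ₗ[𝕜] (Fin n → 𝕜) × (Fin m → 𝕜)}
    (hR : Function.RightInverse R (inputMap E B)) {η : Module.Dual 𝕜 (Fin n → 𝕜)}
    (hη : ∀ k p, inputMap E B p = 0 →
      η (((LinearMap.fst 𝕜 _ _ ∘ₗ R ∘ₗ A.mulVecLin) ^ k) p.1) = 0) :
    ∃ μ : ℕ → Fin ℓ → 𝕜, (∀ s, μ (s + 1) ᵥ* E = μ s ᵥ* A) ∧ (∀ s, μ s ᵥ* B = 0) ∧
      ∀ v, μ 0 ⬝ᵥ E *ᵥ v = η v := by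
  set F := LinearMap.fst 𝕜 _ _ ∘ₗ R ∘ₗ A.mulVecLin
  choose μ hμ using fun k => (dotProductEquiv 𝕜 (Fin ℓ)).surjective
    (η ∘ₗ (F ^ k) ∘ₗ LinearMap.fst 𝕜 _ _ ∘ₗ R)
  have hμ_apply : ∀ k y, μ k ⬝ᵥ y = η ((F ^ k) (R y).1) := fun k y => LinearMap.congr_fun (hμ k) y
  have hμ_input : ∀ k p, μ k ⬝ᵥ inputMap E B p = η ((F ^ k) p.1) := fun k p => by
    rw [hμ_apply, ← sub_eq_zero, ← map_sub, ← map_sub, ← Prod.fst_sub]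
    exact hη k _ (by rw [map_sub, hR, sub_self])
  have hμE : ∀ k v, μ k ⬝ᵥ E *ᵥ v = η ((F ^ k) v) := fun k v => by
    simpa using hμ_input k (v, 0)
  refine ⟨μ, fun s => ?_, fun s => ?_, fun v => hμE 0 v⟩
  · refine dotProduct_eq _ _ fun v => ?_
    rw [← Matrix.dotProduct_mulVec, ← Matrix.dotProduct_mulVec, hμE, hμ_apply, pow_succ]
    rfl
  · refine dotProduct_eq_zero_iff.1 fun v => ?_
    simpa [Matrix.dotProduct_mulVec] using hμ_input s (0, v)

theorem kalmanCondition_of_dualArray_injective (h : Function.Injective (dualArray N (E, A, B)))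
    {R : (Fin ℓ → 𝕜) →ₗ[𝕜] (Fin n → 𝕜) × (Fin m → 𝕜)}
    (hR : Function.RightInverse R (inputMap E B)) :
    KalmanCondition (realCLM (LinearMap.fst 𝕜 _ _ ∘ₗ R ∘ₗ A.mulVecLin))
      (realCLM (LinearMap.fst 𝕜 _ _ ∘ₗ (LinearMap.id - R ∘ₗ inputMap E B))) := by
  intro ξ hξ
  set F := LinearMap.fst 𝕜 _ _ ∘ₗ R ∘ₗ A.mulVecLin
  have hξ_ker : ∀ k p, inputMap E B p = 0 → ξ ((F ^ k) p.1) = 0 := fun k p hp => by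
    simpa only [realCLM_pow, realCLM_apply, LinearMap.comp_apply, LinearMap.fst_apply,
      LinearMap.sub_apply, LinearMap.id_apply, hp, map_zero, sub_zero] using hξ k p
  let η : Module.Dual 𝕜 (Fin n → 𝕜) := Module.Dual.extendRCLike (ξ : (Fin n → 𝕜) →ₗ[ℝ] ℝ)
  have hη_ker : ∀ k p, inputMap E B p = 0 → η ((F ^ k) p.1) = 0 := fun k p hp => by
    have hI := hξ_ker k ((RCLike.I : 𝕜) • p) (by rw [map_smul, hp, smul_zero])
    rw [Prod.smul_fst, map_smul] at hI
    simp [η, Module.Dual.extendRCLike_apply, hξ_ker k p hp, hI]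
  obtain ⟨μ, hμE, hμB, hμ⟩ := exists_vecMul_chain_of_rightInverse hR hη_ker
  have hμ₀ : μ 0 = 0 := dualArray_injective_iff.1 h μ (fun s _ => hμE s) (fun s _ => hμB s) 0
    (Nat.zero_le N)
  have hη : ∀ v, η v = 0 := fun v => by rw [← hμ, hμ₀, zero_dotProduct]
  ext1 v
  simpa [η] using congrArg RCLike.re (hη v)

theorem completelyControllable_of_dualArray_injective
    (h : Function.Injective (dualArray N (E, A, B))) : CompletelyControllable E A B := by
  obtain ⟨R, hR⟩ := (inputMap E B).exists_rightInverse_of_surjective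
    (LinearMap.range_eq_top.2 (inputMap_surjective_of_dualArray_injective h))
  replace hR : Function.RightInverse R (inputMap E B) := LinearMap.congr_fun hR
  refine ⟨1, one_pos, fun x₀ x₁ => ?_⟩
  obtain ⟨v, hv, x, hx, h₀, h₁⟩ :=
    (kalmanCondition_of_dualArray_injective h hR).exists_steering one_pos x₀ x₁
  have hxc : ∀ t, ContinuousAt x t := fun t => (hx t).continuousAt
  exact ⟨_, mem_behaviour_of_rightInverse hR
    (k := fun t => v t - R (inputMap E B (v t)))
    ((realCLM (LinearMap.id - R ∘ₗ inputMap E B)).continuous.comp hv)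
    (fun t => by rw [map_sub, hR, sub_self]) hx, ⟨hxc 0, h₀⟩, hxc 1, h₁⟩

end Underdetermined

end Arrays

section Examples

variable {𝕜 : Type*} [RCLike 𝕜] {p q d : ℕ}

/-- Extension of a finite family by zero. -/
def zeroExt (f : Fin p → 𝕜) (i : ℕ) : 𝕜 := if h : i < p then f ⟨i, h⟩ else 0

theorem zeroExt_val (f : Fin p → 𝕜) (i : Fin p) : zeroExt f i = f i := dif_pos i.2

theorem zeroExt_of_le (f : Fin p → 𝕜) {i : ℕ} (h : p ≤ i) : zeroExt f i = 0 := dif_neg h.not_gt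

theorem sum_ite_val_eq (f : Fin p → 𝕜) (i : ℕ) :
    ∑ j : Fin p, (if (j : ℕ) = i then f j else 0) = zeroExt f i := by
  by_cases h : i < p
  · rw [Finset.sum_eq_single_of_mem ⟨i, h⟩ (Finset.mem_univ _)
      fun j _ hj => if_neg fun hji => hj (Fin.ext hji)]
    simp [zeroExt, h]
  · rw [zeroExt_of_le f (not_lt.1 h)]
    exact Finset.sum_eq_zero fun j _ => if_neg fun hji : (j : ℕ) = i => h (hji ▸ j.2)

/-- The rectangular matrix `v ↦ (0, …, 0, v)` with `d` leading zeros, the result being truncated or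
padded with zeros. -/
def shiftId (𝕜 : Type*) [RCLike 𝕜] (p q d : ℕ) : Matrix (Fin p) (Fin q) 𝕜 :=
  Matrix.of fun i k => if (i : ℕ) = k + d then 1 else 0

theorem shiftId_mulVec (v : Fin q → 𝕜) (i : Fin p) :
    (shiftId 𝕜 p q d *ᵥ v) i = if d ≤ i then zeroExt v (i - d) else 0 := by
  simp only [Matrix.mulVec, dotProduct, shiftId, Matrix.of_apply, ite_mul, one_mul, zero_mul]
  split_ifs with h
  · simp only [← sum_ite_val_eq, Nat.sub_eq_iff_eq_add h, @eq_comm ℕ _ (i - d)]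
  · exact Finset.sum_eq_zero fun k _ => if_neg (by omega)

theorem vecMul_shiftId (v : Fin p → 𝕜) (k : Fin q) :
    (v ᵥ* shiftId 𝕜 p q d) k = zeroExt v (k + d) := by
  simp only [Matrix.vecMul, dotProduct, shiftId, Matrix.of_apply, mul_ite, mul_one, mul_zero,
    sum_ite_val_eq]

theorem zeroExt_shiftId_zero_mulVec (h : q ≤ p) (v : Fin q → 𝕜) (i : ℕ) :
    zeroExt (shiftId 𝕜 p q 0 *ᵥ v) i = zeroExt v i := by
  by_cases hi : i < p
  · simpa using (zeroExt_val _ ⟨i, hi⟩).trans (shiftId_mulVec (d := 0) v ⟨i, hi⟩)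
  · rw [zeroExt_of_le _ (not_lt.1 hi), zeroExt_of_le _ (h.trans (not_lt.1 hi))]

/-- The skew-symmetric tridiagonal matrix with `1` on the superdiagonal. -/
def skewShift (𝕜 : Type*) [RCLike 𝕜] (p : ℕ) : Matrix (Fin p) (Fin p) 𝕜 :=
  (shiftId 𝕜 p p 1)ᵀ - shiftId 𝕜 p p 1

theorem skewShift_eq_neg_conjTranspose (p : ℕ) : skewShift 𝕜 p = -(skewShift 𝕜 p)ᴴ := by
  ext i j
  simp [skewShift, shiftId, apply_ite (starRingEnd 𝕜)]

theorem skewShift_mulVec (v : Fin p → 𝕜) (i : Fin p) :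
    (skewShift 𝕜 p *ᵥ v) i = zeroExt v (i + 1) - if 1 ≤ (i : ℕ) then zeroExt v (i - 1) else 0 := by
  rw [skewShift, Matrix.sub_mulVec, Pi.sub_apply, Matrix.mulVec_transpose, vecMul_shiftId,
    shiftId_mulVec]

theorem eq_zero_of_skewShift_recursion {M : Type*} [AddCommGroup M] {ξ : ℕ → ℕ → M} {N : ℕ}
    (hqN : q ≤ N)
    (hrec : ∀ s < N, ∀ i ≤ q, ξ (s + 1) i = ξ s (i + 1) - if 1 ≤ i then ξ s (i - 1) else 0)
    (hq : ∀ s ≤ N, ∀ i, q ≤ i → ξ s i = 0) : ∀ s ≤ N, ∀ i, ξ s i = 0 := by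
  -- Solving the recursion for `ξ s (i - 1)` moves the boundary of the zero region down by one.
  have hdown : ∀ d s i, q ≤ i + d → s + d ≤ N → ξ s i = 0 := by
    intro d
    induction d with
    | zero => exact fun s i hi hs => hq s hs i hi
    | succ d ih =>
      intro s i hi hs
      by_cases hiq : q ≤ i
      · exact hq s (by omega) i hiq
      · have h := hrec s (by omega) (i + 1) (by omega)
        rw [ih (s + 1) (i + 1) (by omega) (by omega), ih s (i + 1 + 1) (by omega) (by omega)] at h
        simpa using h.symm
  intro s
  induction s with
  | zero => exact fun _ i => hdown N 0 i (by omega) (by omega)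
  | succ s ih =>
    intro hs i
    by_cases hi : i ≤ q
    · rw [hrec s hs i hi, ih (by omega), ih (by omega), ite_self, sub_zero]
    · exact hq _ hs i (by omega)

variable (𝕜) {ℓ n m : ℕ}

theorem genericCondition_inputMap_bijective (h : ℓ = n + m) :
    GenericCondition fun E (_ : Matrix (Fin ℓ) (Fin n) 𝕜) (B : Matrix (Fin ℓ) (Fin m) 𝕜) =>
      Function.Bijective (inputMap E B) := by
  let Λ : (Matrix (Fin ℓ) (Fin n) 𝕜 × Matrix (Fin ℓ) (Fin n) 𝕜 × Matrix (Fin ℓ) (Fin m) 𝕜) →ₗ[𝕜]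
      ((Fin n → 𝕜) × (Fin m → 𝕜)) →ₗ[𝕜] (Fin ℓ → 𝕜) :=
    LinearMap.mk₂ 𝕜 (fun p y => inputMap p.1 p.2.2 y)
      (fun p q y => by
        simp only [inputMap_apply, Prod.fst_add, Prod.snd_add, Matrix.add_mulVec]
        abel)
      (fun c p y => by
        simp only [inputMap_apply, Prod.smul_fst, Prod.smul_snd, Matrix.smul_mulVec, smul_sub])
      (fun p y z => map_add _ _ _) (fun c p y => map_smul _ _ _)
  have h₁ : Function.Injective (inputMap (shiftId 𝕜 ℓ n 0) (shiftId 𝕜 ℓ m n)) := by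
    refine (injective_iff_map_eq_zero _).2 fun ⟨v, u⟩ hvu => ?_
    rw [inputMap_apply, sub_eq_zero] at hvu
    have hrow : ∀ i : Fin ℓ, zeroExt v i = if n ≤ i then zeroExt u (i - n) else 0 := fun i => by
      rw [← shiftId_mulVec, ← hvu, shiftId_mulVec, if_pos (Nat.zero_le _), Nat.sub_zero]
    refine Prod.ext (funext fun j => ?_) (funext fun k => ?_)
    · simpa [zeroExt_val, j.2.not_ge] using hrow ⟨j, by omega⟩
    · simpa [zeroExt_val, zeroExt_of_le] using (hrow ⟨n + k, by omega⟩).symm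
  refine (genericCondition_injective Λ (skewShift_eq_neg_conjTranspose ℓ) h₁).mono
    fun E A B hi => ?_
  exact ⟨hi, (LinearMap.injective_iff_surjective_of_finrank_eq_finrank (by simp [h])).1 hi⟩

theorem genericCondition_derivArray_injective (h : n + m < ℓ) :
    GenericCondition fun (E A : Matrix (Fin ℓ) (Fin n) 𝕜) (B : Matrix (Fin ℓ) (Fin m) 𝕜) =>
      Function.Injective (derivArray ℓ (E, A, B)) := by
  refine genericCondition_injective (derivArray ℓ) (E₁ := shiftId 𝕜 ℓ n 0)
    (B₁ := shiftId 𝕜 ℓ m (n + 1)) (skewShift_eq_neg_conjTranspose ℓ)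
    (derivArray_injective_iff.2 fun x u hxu => ?_)
  have hrow : ∀ s < ℓ, ∀ i : Fin ℓ, zeroExt (x (s + 1)) i =
      (zeroExt (x s) (i + 1) - if 1 ≤ (i : ℕ) then zeroExt (x s) (i - 1) else 0) +
        if n + 1 ≤ (i : ℕ) then zeroExt (u s) (i - (n + 1)) else 0 := fun s hs i => by
    have hE := congrFun (hxu s hs) i
    rwa [Pi.add_apply, ← Matrix.mulVec_mulVec, skewShift_mulVec, shiftId_mulVec, shiftId_mulVec,
      if_pos (Nat.zero_le _), Nat.sub_zero, zeroExt_shiftId_zero_mulVec (by omega),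
      zeroExt_shiftId_zero_mulVec (by omega)] at hE
  have hx := eq_zero_of_skewShift_recursion (ξ := fun s => zeroExt (x s)) (q := n) (N := ℓ)
    (by omega)
    (fun s hs i hi => by simpa [show ¬ n + 1 ≤ i by omega] using hrow s hs ⟨i, by omega⟩)
    (fun s _ i hi => zeroExt_of_le _ hi)
  refine ⟨fun s hs => funext fun j => ?_, fun s hs => funext fun k => ?_⟩
  · exact (zeroExt_val _ j).symm.trans (hx s hs j)
  · simpa [hx s hs.le, hx (s + 1) hs, zeroExt_val] using
      (hrow s hs ⟨n + 1 + k, by omega⟩).symm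

theorem genericCondition_dualArray_injective (hℓ : 0 < ℓ) (hn : 0 < n) (hm : 0 < m)
    (h : ℓ < n + m) :
    GenericCondition fun (E A : Matrix (Fin ℓ) (Fin n) 𝕜) (B : Matrix (Fin ℓ) (Fin m) 𝕜) =>
      Function.Injective (dualArray ℓ (E, A, B)) := by
  obtain ⟨d, hd⟩ : ∃ d, min ℓ n = d + 1 := ⟨min ℓ n - 1, by omega⟩
  have hskew : (skewShift 𝕜 ℓ)ᵀ = -((skewShift 𝕜 ℓ)ᵀ)ᴴ := by
    rw [Matrix.conjTranspose_transpose_eq_transpose_conjTranspose, ← Matrix.transpose_neg,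
      ← skewShift_eq_neg_conjTranspose]
  refine genericCondition_injective (dualArray ℓ) (E₁ := shiftId 𝕜 ℓ n 0)
    (B₁ := shiftId 𝕜 ℓ m d) hskew (dualArray_injective_iff.2 fun μ hμE hμB => ?_)
  have hrec : ∀ s < ℓ, ∀ i ≤ d, zeroExt (μ (s + 1)) i =
      zeroExt (μ s) (i + 1) - if 1 ≤ i then zeroExt (μ s) (i - 1) else 0 := fun s hs i hi => by
    have hE := congrFun (hμE s hs) ⟨i, by omega⟩
    rw [← Matrix.vecMul_vecMul, Matrix.vecMul_transpose, vecMul_shiftId, vecMul_shiftId] at hE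
    exact hE.trans ((zeroExt_val _ ⟨i, by omega⟩).trans (skewShift_mulVec _ _))
  have hzero : ∀ s ≤ ℓ, ∀ i, d ≤ i → zeroExt (μ s) i = 0 := fun s hs i hi => by
    by_cases hiℓ : i < ℓ
    · have hB := congrFun (hμB s hs) ⟨i - d, by omega⟩
      rwa [vecMul_shiftId, Nat.sub_add_cancel hi] at hB
    · exact zeroExt_of_le _ (not_lt.1 hiℓ)
  refine fun s hs => funext fun j => ?_
  exact (zeroExt_val _ j).symm.trans (eq_zero_of_skewShift_recursion
    (ξ := fun s => zeroExt (μ s)) (by omega) hrec hzero s hs j)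

end Examples

section Dichotomy

/-- The dimensions for which a concept holds generically. -/
def CtrlConcept.Expected (ℓ n m : ℕ) : CtrlConcept → Prop
  | .freelyInitializable => ℓ ≤ n + m
  | .impulseControllable => ℓ ≤ n + m
  | .behaviourallyControllable => ℓ ≠ n + m
  | .completelyControllable => ℓ < n + m
  | .stronglyControllable => ℓ < n + m

variable {𝕜 : Type*} [RCLike 𝕜] {ℓ n m : ℕ}

section HoldsIffExpected

variable {E A : Matrix (Fin ℓ) (Fin n) 𝕜} {B : Matrix (Fin ℓ) (Fin m) 𝕜}

theorem CompletelyControllable.holds_iff_expected (h : ℓ < n + m)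
    (hc : CompletelyControllable E A B) (c : CtrlConcept) :
    c.Holds E A B ↔ c.Expected ℓ n m := by
  cases c
  · exact iff_of_true hc.freelyInitializable h.le
  · exact iff_of_true hc.freelyInitializable.impulseControllable h.le
  · exact iff_of_true hc.stronglyControllable.behaviourallyControllable h.ne
  · exact iff_of_true hc h
  · exact iff_of_true hc.stronglyControllable h

theorem holds_iff_expected_of_inputMap_bijective (hn : 0 < n) (h : ℓ = n + m)
    (hb : Function.Bijective (inputMap E B)) (c : CtrlConcept) :
    c.Holds E A B ↔ c.Expected ℓ n m := by
  have hf : FreelyInitializable E A B := freelyInitializable_of_inputMap_surjective hb.2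
  have hs : ¬ StronglyControllable E A B := not_stronglyControllable_of_inputMap_injective hn hb.1
  cases c
  · exact iff_of_true hf h.le
  · exact iff_of_true hf.impulseControllable h.le
  · exact iff_of_false (not_behaviourallyControllable_of_inputMap_bijective hn hb) (not_not.2 h)
  · exact iff_of_false (fun hc => hs hc.stronglyControllable) h.not_lt
  · exact iff_of_false hs h.not_lt

theorem holds_iff_expected_of_derivArray_injective {N : ℕ} (hn : 0 < n) (hN : 0 < N)
    (h : n + m < ℓ) (hi : Function.Injective (derivArray N (E, A, B))) (c : CtrlConcept) :
    c.Holds E A B ↔ c.Expected ℓ n m := by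
  have hI := not_impulseControllable_of_derivArray_injective hn hN hi
  have hs : ¬ StronglyControllable E A B := not_stronglyControllable_of_inputMap_injective hn
    (inputMap_injective_of_derivArray_injective hN hi)
  cases c
  · exact iff_of_false (fun hf => hI hf.impulseControllable) h.not_ge
  · exact iff_of_false hI h.not_ge
  · exact iff_of_true (behaviourallyControllable_of_derivArray_injective hN hi) h.ne'
  · exact iff_of_false (fun hc => hs hc.stronglyControllable) h.not_gt
  · exact iff_of_false hs h.not_gt

end HoldsIffExpected

theorem genericCondition_holds_iff_expected (𝕜 : Type*) [RCLike 𝕜] (hℓ : 0 < ℓ) (hn : 0 < n)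
    (hm : 0 < m) :
    GenericCondition fun (E A : Matrix (Fin ℓ) (Fin n) 𝕜) (B : Matrix (Fin ℓ) (Fin m) 𝕜) =>
      ∀ c : CtrlConcept, c.Holds E A B ↔ c.Expected ℓ n m := by
  rcases lt_trichotomy ℓ (n + m) with h | h | h
  · exact (genericCondition_dualArray_injective 𝕜 hℓ hn hm h).mono fun _ _ _ hi =>
      (completelyControllable_of_dualArray_injective hi).holds_iff_expected h
  · exact (genericCondition_inputMap_bijective 𝕜 h).mono fun _ _ _ =>
      holds_iff_expected_of_inputMap_bijective hn h
  · exact (genericCondition_derivArray_injective 𝕜 h).mono fun _ _ _ =>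
      holds_iff_expected_of_derivArray_injective hn hℓ h

/-- The alternative for a class `V` of systems, with `S c` the set of its members having property
`c`: `S c` is relative generic in the expected dimensions, and its complement in all others. -/
def GenericDichotomy {X : Type*} [AddCommGroup X] [Module ℝ X] (ℓ n m : ℕ)
    (S : CtrlConcept → Set X) (V : Set X) : Prop :=
  (∀ c, RelGeneric (S c) V ↔ c.Expected ℓ n m) ∧ ∀ c, ¬ RelGeneric (S c) V → RelGeneric (S c)ᶜ V

theorem genericDichotomy_phClass {Y : Type*} [AddCommGroup Y] [Module ℝ Y] [TopologicalSpace Y]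
    [IsTopologicalAddGroup Y] [ContinuousSMul ℝ Y] [T2Space Y] [FiniteDimensional ℝ Y]
    (hℓ : 0 < ℓ) (hn : 0 < n) (hm : 0 < m) {σ : Y →ₗ[ℝ] Matrix (Fin ℓ) (Fin ℓ) 𝕜} {𝒮 : Set Y}
    (h𝒮 : SkewAccessible σ 𝒮) (hne : 𝒮.Nonempty) :
    GenericDichotomy ℓ n m
      (fun c => {x | x ∈ phClass 𝕜 ℓ n m 𝒮 ∧ c.Holds x.1 (σ x.2.1 * x.2.2.1) x.2.2.2})
      (phClass 𝕜 ℓ n m 𝒮) := by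
  have hgen := genericCondition_holds_iff_expected (ℓ := ℓ) (n := n) (m := m) 𝕜 hℓ hn hm
  have hV : (phClass 𝕜 ℓ n m 𝒮).Nonempty :=
    let ⟨y, hy⟩ := hne
    ⟨(0, y, 0, 0), hy, by simp, by simpa using Matrix.PosSemidef.zero⟩
  have hpos : ∀ c : CtrlConcept, c.Expected ℓ n m → RelGeneric {x | x ∈ phClass 𝕜 ℓ n m 𝒮 ∧
      c.Holds x.1 (σ x.2.1 * x.2.2.1) x.2.2.2} (phClass 𝕜 ℓ n m 𝒮) := fun c hc =>
    hgen.relGeneric_phClass h𝒮 fun _ _ _ _ hx h => ⟨hx, (h c).2 hc⟩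
  have hneg : ∀ c : CtrlConcept, ¬ c.Expected ℓ n m → RelGeneric {x | x ∈ phClass 𝕜 ℓ n m 𝒮 ∧
      c.Holds x.1 (σ x.2.1 * x.2.2.1) x.2.2.2}ᶜ (phClass 𝕜 ℓ n m 𝒮) := fun c hc =>
    hgen.relGeneric_phClass h𝒮 fun _ _ _ _ _ h hx => hc ((h c).1 hx.2)
  exact ⟨fun c => ⟨fun hg => by_contra fun hc => hg.not_compl hV (hneg c hc), hpos c⟩,
    fun c hg => hneg c fun hc => hg (hpos c hc)⟩

theorem GenericDichotomy.preimage {X X' : Type*} [AddCommGroup X] [Module ℝ X] [AddCommGroup X']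
    [Module ℝ X'] {S : CtrlConcept → Set X'} {V : Set X'} (h : GenericDichotomy ℓ n m S V)
    (e : X ≃ₗ[ℝ] X') : GenericDichotomy ℓ n m (fun c => e ⁻¹' S c) (e ⁻¹' V) := by
  simpa only [GenericDichotomy, ← Set.preimage_compl, relGeneric_preimage_iff e] using h

theorem eq_neg_conjTranspose_of_mem_openSegment {κ : Type*} {J J₁ J₂ : Matrix κ κ 𝕜}
    (h₁ : J₁ = -J₁ᴴ) (h₂ : J₂ = -J₂ᴴ) (hJ : J ∈ openSegment ℝ J₁ J₂) : J = -Jᴴ := by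
  obtain ⟨a, b, -, -, -, rfl⟩ := hJ
  rw [Matrix.conjTranspose_add, Matrix.conjTranspose_smul, Matrix.conjTranspose_smul, star_trivial,
    star_trivial, neg_add, ← smul_neg, ← smul_neg, ← h₁, ← h₂]

theorem genericDichotomy_sigmaH (hℓ : 0 < ℓ) (hn : 0 < n) (hm : 0 < m) :
    GenericDichotomy ℓ n m (ctrlH 𝕜 ℓ n m) (SigmaH 𝕜 ℓ n m) := by
  have h𝒮 : SkewAccessible LinearMap.id {J : Matrix (Fin ℓ) (Fin ℓ) 𝕜 | J = -Jᴴ} := fun J₁ hJ₁ =>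
    ⟨J₁, rfl, fun _ hJ _ => eq_neg_conjTranspose_of_mem_openSegment hJ hJ₁⟩
  have h := genericDichotomy_phClass hℓ hn hm h𝒮 ⟨0, by simp⟩
  convert h using 2 <;> ext <;> simp [ctrlH, SigmaH, phClass, and_assoc]

/-- Reassociation `(E, J, R, Q, B) ↦ (E, (J, R), Q, B)` of a system with dissipation. -/
noncomputable def quintupleEquiv (𝕜 : Type*) [RCLike 𝕜] (ℓ n m : ℕ) : Quintuple 𝕜 ℓ n m ≃ₗ[ℝ]
    Matrix (Fin ℓ) (Fin n) 𝕜 × (Matrix (Fin ℓ) (Fin ℓ) 𝕜 × Matrix (Fin ℓ) (Fin ℓ) 𝕜) ×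
      Matrix (Fin ℓ) (Fin n) 𝕜 × Matrix (Fin ℓ) (Fin m) 𝕜 :=
  (LinearEquiv.refl ℝ _).prodCongr (LinearEquiv.prodAssoc ℝ _ _ _).symm

theorem quintupleEquiv_apply (x : Quintuple 𝕜 ℓ n m) :
    quintupleEquiv 𝕜 ℓ n m x = (x.1, (x.2.1, x.2.2.1), x.2.2.2.1, x.2.2.2.2) :=
  rfl

theorem skewAccessible_sub {𝓡 : Set (Matrix (Fin ℓ) (Fin ℓ) 𝕜)}
    (h𝓡 : ∀ R ∈ 𝓡, ∀ s : ℝ, 0 < s → s • R ∈ 𝓡) :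
    SkewAccessible (LinearMap.fst ℝ (Matrix (Fin ℓ) (Fin ℓ) 𝕜) (Matrix (Fin ℓ) (Fin ℓ) 𝕜) -
      LinearMap.snd ℝ _ _) {y | y.1 = -y.1ᴴ ∧ y.2 ∈ 𝓡} := by
  refine fun J₁ hJ₁ => ⟨(J₁, 0), by simp, fun ⟨J, R⟩ ⟨hJ, hR⟩ => ?_⟩
  rintro _ ⟨a, b, ha, hb, hab, rfl⟩
  refine ⟨eq_neg_conjTranspose_of_mem_openSegment hJ hJ₁ ⟨a, b, ha, hb, hab, rfl⟩, ?_⟩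
  simpa using h𝓡 R hR a ha

theorem genericDichotomy_sigmaSdH (hℓ : 0 < ℓ) (hn : 0 < n) (hm : 0 < m) :
    GenericDichotomy ℓ n m (ctrlSdH 𝕜 ℓ n m) (SigmaSdH 𝕜 ℓ n m) := by
  have h𝒮 := skewAccessible_sub (𝓡 := {R : Matrix (Fin ℓ) (Fin ℓ) 𝕜 | R = Rᴴ ∧ R.PosSemidef})
    fun R hR s hs => ⟨((hR.2.smul hs.le).isHermitian.eq).symm, hR.2.smul hs.le⟩
  have h := (genericDichotomy_phClass hℓ hn hm h𝒮
    ⟨0, by simp [Matrix.PosSemidef.zero]⟩).preimage (quintupleEquiv 𝕜 ℓ n m)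
  convert h using 2 <;> ext <;> simp [ctrlSdH, SigmaSdH, phClass, quintupleEquiv_apply, and_assoc]

theorem genericDichotomy_sigmaDH (hℓ : 0 < ℓ) (hn : 0 < n) (hm : 0 < m) :
    GenericDichotomy ℓ n m (ctrlDH 𝕜 ℓ n m) (SigmaDH 𝕜 ℓ n m) := by
  have h𝒮 := skewAccessible_sub (𝓡 := {R : Matrix (Fin ℓ) (Fin ℓ) 𝕜 | R = Rᴴ ∧ R.PosDef})
    fun R hR s hs => ⟨((hR.2.smul hs).isHermitian.eq).symm, hR.2.smul hs⟩
  have h := (genericDichotomy_phClass hℓ hn hm h𝒮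
    ⟨(0, 1), by simp [Matrix.PosDef.one]⟩).preimage (quintupleEquiv 𝕜 ℓ n m)
  convert h using 2 <;> ext <;> simp [ctrlDH, SigmaDH, phClass, quintupleEquiv_apply, and_assoc]

end Dichotomy

end PortHamiltonian

theorem mainTheorem1 (𝕜 : Type*) [RCLike 𝕜] (ℓ n m : ℕ) (hℓ : 0 < ℓ) (hn : 0 < n) (hm : 0 < m) :
    ((RelGeneric (ctrlH 𝕜 ℓ n m .freelyInitializable) (SigmaH 𝕜 ℓ n m) ↔ ℓ ≤ n + m) ∧
     (RelGeneric (ctrlH 𝕜 ℓ n m .impulseControllable) (SigmaH 𝕜 ℓ n m) ↔ ℓ ≤ n + m) ∧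
     (RelGeneric (ctrlH 𝕜 ℓ n m .behaviourallyControllable) (SigmaH 𝕜 ℓ n m) ↔ ℓ ≠ n + m) ∧
     (RelGeneric (ctrlH 𝕜 ℓ n m .completelyControllable) (SigmaH 𝕜 ℓ n m) ↔ ℓ < n + m) ∧
     (RelGeneric (ctrlH 𝕜 ℓ n m .stronglyControllable) (SigmaH 𝕜 ℓ n m) ↔ ℓ < n + m) ∧
     (∀ c : CtrlConcept, ¬ RelGeneric (ctrlH 𝕜 ℓ n m c) (SigmaH 𝕜 ℓ n m) →
      RelGeneric (ctrlH 𝕜 ℓ n m c)ᶜ (SigmaH 𝕜 ℓ n m))) ∧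
    ((RelGeneric (ctrlSdH 𝕜 ℓ n m .freelyInitializable) (SigmaSdH 𝕜 ℓ n m) ↔ ℓ ≤ n + m) ∧
     (RelGeneric (ctrlSdH 𝕜 ℓ n m .impulseControllable) (SigmaSdH 𝕜 ℓ n m) ↔ ℓ ≤ n + m) ∧
     (RelGeneric (ctrlSdH 𝕜 ℓ n m .behaviourallyControllable) (SigmaSdH 𝕜 ℓ n m) ↔ ℓ ≠ n + m) ∧
     (RelGeneric (ctrlSdH 𝕜 ℓ n m .completelyControllable) (SigmaSdH 𝕜 ℓ n m) ↔ ℓ < n + m) ∧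
     (RelGeneric (ctrlSdH 𝕜 ℓ n m .stronglyControllable) (SigmaSdH 𝕜 ℓ n m) ↔ ℓ < n + m) ∧
     (∀ c : CtrlConcept, ¬ RelGeneric (ctrlSdH 𝕜 ℓ n m c) (SigmaSdH 𝕜 ℓ n m) →
      RelGeneric (ctrlSdH 𝕜 ℓ n m c)ᶜ (SigmaSdH 𝕜 ℓ n m))) ∧
    ((RelGeneric (ctrlDH 𝕜 ℓ n m .freelyInitializable) (SigmaDH 𝕜 ℓ n m) ↔ ℓ ≤ n + m) ∧
     (RelGeneric (ctrlDH 𝕜 ℓ n m .impulseControllable) (SigmaDH 𝕜 ℓ n m) ↔ ℓ ≤ n + m) ∧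
     (RelGeneric (ctrlDH 𝕜 ℓ n m .behaviourallyControllable) (SigmaDH 𝕜 ℓ n m) ↔ ℓ ≠ n + m) ∧
     (RelGeneric (ctrlDH 𝕜 ℓ n m .completelyControllable) (SigmaDH 𝕜 ℓ n m) ↔ ℓ < n + m) ∧
     (RelGeneric (ctrlDH 𝕜 ℓ n m .stronglyControllable) (SigmaDH 𝕜 ℓ n m) ↔ ℓ < n + m) ∧
     (∀ c : CtrlConcept, ¬ RelGeneric (ctrlDH 𝕜 ℓ n m c) (SigmaDH 𝕜 ℓ n m) →
      RelGeneric (ctrlDH 𝕜 ℓ n m c)ᶜ (SigmaDH 𝕜 ℓ n m))) := by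
  obtain ⟨hH, hH'⟩ := genericDichotomy_sigmaH (𝕜 := 𝕜) hℓ hn hm
  obtain ⟨hSdH, hSdH'⟩ := genericDichotomy_sigmaSdH (𝕜 := 𝕜) hℓ hn hm
  obtain ⟨hDH, hDH'⟩ := genericDichotomy_sigmaDH (𝕜 := 𝕜) hℓ hn hm
  exact ⟨⟨hH _, hH _, hH _, hH _, hH _, hH'⟩, ⟨hSdH _, hSdH _, hSdH _, hSdH _, hSdH _, hSdH'⟩,
    ⟨hDH _, hDH _, hDH _, hDH _, hDH _, hDH'⟩⟩
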